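/- Let $L>0$, $\alpha>0$, and let $f,g:\mathbb R\to\mathbb R$ be locally Lipschitz. Let $\Lambda(\alpha)$ be the set of nonnegative $L$-periodic $b\in C^1(\mathbb R)$ with $\int_{[0,L)}b\,dx=\alpha L$, and let $\overline\Lambda(\alpha)$ be its sequential closure in the space of distributions on $\mathbb R$; its elements are nonnegative distributions and are identified with (locally finite Borel) measures $\bar b(x)\,dx$. For $\bar b\in\overline\Lambda(\alpha)$ and nonnegative $u_0\in C(\mathbb R^2)\cap L^\infty(\mathbb R^2)$ consider $$u_t=u_{xx}+u_{yy}+\bar b(x)f(u)+g(u)\quad(x,y\in\mathbb R,\ t>0),\qquad u(x,y,0)=u_0(x,y).\tag{1}$$ Put $G(x,y,t)=\frac1{4\pi t}e^{-(x^2+y^2)/(4t)}$. For $T\in(0,\infty]$, a mild solution of (1) on $(0,T)$ is a continuous $u:\mathbb R^2\times(0,T)\to\mathbb R$ with $\lim_{t\searrow0}u(x,y,t)=u_0(x,y)$ for all $x,y$ and $$u(x,y,t)=\int_{\mathbb R^2}G(x-x',y-y',t)u_0(x',y')\,dx'dy'+\int_0^t\!\int_{\mathbb R^2}G(x-x',y-y',t-s)\big(\bar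 b(x')f(u(x',y',s))+g(u(x',y',s))\big)dx'dy'ds$$ for all $x,y\in\mathbb R$ and $t\in(0,T)$, with absolutely convergent integrals. It is called bounded if it is bounded on $\mathbb R^2\times(0,\tau]$ for every $\tau\in(0,T)$. A weak solution on $(0,T)$ is a continuous $u:\mathbb R^2\times(0,T)\to\mathbb R$ such that for all $\eta\in C_c^\infty(\mathbb R^2\times(0,T))$ $$-\int_0^T\!\int_{\mathbb R^2}u\,\eta_t\,dxdydt=\int_0^T\!\int_{\mathbb R^2}\big(u\eta_{xx}+u\eta_{yy}+\bar b(x)f(u)\eta+g(u)\eta\big)dxdydt.$$ Theorem. For every $\bar b\in\overline\Lambda(\alpha)$ and every nonnegative $u_0\in C(\mathbb R^2)\cap L^\infty(\mathbb R^2)$: 1. There is $T\in(0,\infty]$ such that (1) has a bounded mild solution on $(0,T)$. 2. For every $T\in(0,\infty]$, (1) has at most one bounded mild solution on $(0,T)$. 3. Every bounded mild solution of (1) on an interval $(0,T)$ is a weak solution on $(0,T)$. 4. Let $u$ be a bounded mild solution of (1) on $(0,T)$, let $u^0_n\in C(\mathbb R^2)\cap L^\infty(\mathbb R^2)$ be nonnegative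 with $u_n^0\to u_0$ in $L^\infty$, and let $t\in(0,T)$. Then for all large $n$ the problem (1) with initial data $u^0_n$ has a bounded mild solution $u_n$ on some interval $(0,S_n)$ with $S_n>t$, and for any such solutions $u_n(\cdot,\cdot,t)\to u(\cdot,\cdot,t)$ in $L^\infty(\mathbb R^2)$ as $n\to\infty$. -/

import Mathlib

open MeasureTheory Filter Topology Set
open scoped ContDiff BoundedContinuousFunction

noncomputable section

namespace StratifiedKPP

/-- `Λ(α)`: the nonnegative, `L`-periodic `C¹` functions `b` on `ℝ` whose integral over one
period is `α L`. -/
def Lam (L α : ℝ) : Set (ℝ → ℝ) :=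
  {b | ContDiff ℝ 1 b ∧ (∀ x, 0 ≤ b x) ∧ (∀ x, b (x + L) = b x) ∧
    ∫ x in Ico 0 L, b x = α * L}

/-- The sequential closure of `Λ(α)` in the space of distributions on `ℝ`. Its elements are
nonnegative distributions, i.e. Radon (on `ℝ`: locally finite Borel) measures, and are treated
as such: `μ` belongs to it iff some sequence in `Λ(α)` converges to `μ` when tested against
every `η ∈ C_c^∞(ℝ)`. -/
def LamBar (L α : ℝ) : Set (Measure ℝ) :=
  {μ | IsLocallyFiniteMeasure μ ∧ ∃ b : ℕ → ℝ → ℝ, (∀ n, b n ∈ Lam L α) ∧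
    ∀ η : ℝ → ℝ, ContDiff ℝ ∞ η → HasCompactSupport η →
      Tendsto (fun n => ∫ x, b n x * η x) atTop (𝓝 (∫ x, η x ∂μ))}

/-- The two-dimensional heat kernel `G(x, y, t)`. -/
def heatKernel (x y t : ℝ) : ℝ :=
  1 / (4 * Real.pi * t) * Real.exp (-(x ^ 2 + y ^ 2) / (4 * t))

/-- The open time interval `(0, T)`, where `T = ∞` (that is, `⊤`) is allowed. -/
def timeInterval (T : EReal) : Set ℝ := {t | 0 < t ∧ (t : EReal) < T}

/-- `u` is a weak solution of `u_t = u_xx + u_yy + μ f(u) + g(u)` on `ℝ² × I`, where `I` is an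
open interval. A point of `ℝ² × I` is written `((x, y), t)`, and the term with the measure
`μ(dx)` is integrated against `μ(dx) dy dt`. -/
def IsWeakSolution (f g : ℝ → ℝ) (μ : Measure ℝ) (I : Set ℝ) (u : ℝ × ℝ → ℝ → ℝ) : Prop :=
  ContinuousOn (fun p : (ℝ × ℝ) × ℝ => u p.1 p.2) (univ ×ˢ I) ∧
  ∀ η : (ℝ × ℝ) × ℝ → ℝ, ContDiff ℝ ∞ η → HasCompactSupport η → tsupport η ⊆ univ ×ˢ I →
    -∫ t in I, ∫ z : ℝ × ℝ, u z t * deriv (fun s => η (z, s)) t =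
      (∫ t in I, ∫ z : ℝ × ℝ,
        (u z t * iteratedDeriv 2 (fun x => η ((x, z.2), t)) z.1
          + u z t * iteratedDeriv 2 (fun y => η ((z.1, y), t)) z.2
          + g (u z t) * η (z, t)))
      + ∫ t in I, ∫ z : ℝ × ℝ, f (u z t) * η (z, t) ∂(μ.prod volume)

/-- `u` is a mild solution on `ℝ² × (0, T)` of `u_t = u_xx + u_yy + μ f(u) + g(u)` with initial
data `u₀`: it is continuous, it converges pointwise to `u₀` as `t ↓ 0`, and it satisfies the
Duhamel formula, all integrals in which are required to converge absolutely. -/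
structure IsMildSolution (f g : ℝ → ℝ) (μ : Measure ℝ) (u₀ : ℝ × ℝ → ℝ) (T : EReal)
    (u : ℝ × ℝ → ℝ → ℝ) : Prop where
  pos : 0 < T
  continuousOn : ContinuousOn (fun p : (ℝ × ℝ) × ℝ => u p.1 p.2) (univ ×ˢ timeInterval T)
  initial : ∀ z, Tendsto (fun t => u z t) (𝓝[>] 0) (𝓝 (u₀ z))
  integrable_initial : ∀ z : ℝ × ℝ, ∀ t ∈ timeInterval T,
    Integrable (fun w : ℝ × ℝ => heatKernel (z.1 - w.1) (z.2 - w.2) t * u₀ w)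
  integrable_f : ∀ z : ℝ × ℝ, ∀ t ∈ timeInterval T,
    Integrable (fun p : ℝ × (ℝ × ℝ) =>
        heatKernel (z.1 - p.2.1) (z.2 - p.2.2) (t - p.1) * f (u p.2 p.1))
      ((volume.restrict (Ioo 0 t)).prod (μ.prod volume))
  integrable_g : ∀ z : ℝ × ℝ, ∀ t ∈ timeInterval T,
    Integrable (fun p : ℝ × (ℝ × ℝ) =>
        heatKernel (z.1 - p.2.1) (z.2 - p.2.2) (t - p.1) * g (u p.2 p.1))
      ((volume.restrict (Ioo 0 t)).prod volume)
  duhamel : ∀ z : ℝ × ℝ, ∀ t ∈ timeInterval T,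
    u z t =
      (∫ w : ℝ × ℝ, heatKernel (z.1 - w.1) (z.2 - w.2) t * u₀ w)
      + ∫ s in Ioo 0 t,
          ((∫ w : ℝ × ℝ, heatKernel (z.1 - w.1) (z.2 - w.2) (t - s) * f (u w s)
              ∂(μ.prod volume))
            + ∫ w : ℝ × ℝ, heatKernel (z.1 - w.1) (z.2 - w.2) (t - s) * g (u w s))

/-- A mild solution on `ℝ² × (0, T)` that is bounded on `ℝ² × (0, τ]` for every `τ < T`. -/
def IsBoundedMildSolution (f g : ℝ → ℝ) (μ : Measure ℝ) (u₀ : ℝ × ℝ → ℝ) (T : EReal)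
    (u : ℝ × ℝ → ℝ → ℝ) : Prop :=
  IsMildSolution f g μ u₀ T u ∧
    ∀ τ ∈ timeInterval T, ∃ M : ℝ, ∀ z, ∀ t ∈ Ioc 0 τ, |u z t| ≤ M

end StratifiedKPP

end

/-!
# Mild solutions of a reaction-diffusion equation with a measure-valued coefficient

The only property of `μ ∈ LamBar L α` that matters is that it is uniformly locally finite: a bump
function shows that every interval of length `L` has `μ`-mass at most `2 α L`
(`LamBar.measure_Icc_le`). Comparing a one-dimensional Gaussian with its averages over short
intervals then gives, for `ν = μ ⊗ dy`,
`∫ G(z - w, r) ν(dw) ≤ A (1 + r^{-1/2})` uniformly in `z` (`HasHeatBound`, `hasHeatBound_prod`).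
This profile is integrable at `r = 0`, so the measure-valued reaction term can be treated like the
regular one.

Quantitatively, a source bounded by `B e^{λ s}` has a Duhamel integral bounded by
`B A c(λ) e^{λ t}`, where `c(λ) = 1/λ + √(π/λ)` tends to `0` as `λ → ∞`
(`abs_integral_spaceTime_le`). For globally Lipschitz nonlinearities and large `λ` the Duhamel map
is therefore a contraction in the norm weighted by `e^{-λ t}`. This gives global solutions when the
nonlinearities are moreover bounded (`exists_global_mild`) and Lipschitz dependence on the initial
data (`abs_sub_le_of_mild`). The continuity that the fixed-point space asks for is
`continuous_heatEvol` and `continuous_duhamel`.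

Locally Lipschitz `f` and `g` are frozen outside `[-M, M]` (`trunc`). A solution bounded by `M` does
not see the difference, so uniqueness, local existence and continuous dependence follow from the
truncated problem; in the last case `M` is one unit above a bound of the given solution, and
nearby data produce solutions that stay below `M` (`exists_mild_near`).

For the weak formulation, `(∂ₜ + Δ) η` is paired with the Duhamel formula and the order of
integration is exchanged (`integral_adjointHeat_potential`). What remains is that the heat kernel is
the fundamental solution, `∫∫ G(w - z, r) (∂ₜ + Δ) η(z, s + r) dz dr = -η(w, s)`
(`integral_heatEvol_adjointHeat`). The initial data count as one more source, carried by the slice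
`s = 0`, where `η` vanishes.
-/

namespace StratifiedKPP

/-! ### Mass of the heat kernel against uniformly locally finite measures -/

/-- The heat kernel `G(z - w, r)` as a function of two points of the plane. -/
noncomputable abbrev heatK (z w : ℝ × ℝ) (r : ℝ) : ℝ := heatKernel (z.1 - w.1) (z.2 - w.2) r

theorem heatKernel_nonneg (x y : ℝ) {r : ℝ} (hr : 0 ≤ r) : 0 ≤ heatKernel x y r := by
  unfold heatKernel; positivity

theorem heatK_nonneg (z w : ℝ × ℝ) {r : ℝ} (hr : 0 ≤ r) : 0 ≤ heatK z w r :=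
  heatKernel_nonneg _ _ hr

theorem measurable_heatKernel :
    Measurable (fun p : ℝ × ℝ × ℝ => heatKernel p.1 p.2.1 p.2.2) := by
  unfold heatKernel; fun_prop

@[fun_prop]
theorem _root_.Measurable.heatKernel {X : Type*} [MeasurableSpace X] {a b c : X → ℝ}
    (ha : Measurable a) (hb : Measurable b) (hc : Measurable c) :
    Measurable (fun x => StratifiedKPP.heatKernel (a x) (b x) (c x)) :=
  measurable_heatKernel.comp (ha.prodMk (hb.prodMk hc))

theorem continuous_heatKernel (r : ℝ) :
    Continuous (fun p : ℝ × ℝ => heatKernel p.1 p.2 r) := by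
  unfold heatKernel; fun_prop

theorem heatKernel_eq_mul (x y r : ℝ) :
    heatKernel x y r = 1 / (4 * Real.pi * r) *
      (Real.exp (-x ^ 2 / (4 * r)) * Real.exp (-y ^ 2 / (4 * r))) := by
  unfold heatKernel
  rw [← Real.exp_add]; congr 2; ring

/-- Moving the centre of the heat kernel by at most one unit costs a factor depending on `r`
and a doubling of time. -/
theorem heatK_le_of_near {z z₀ : ℝ × ℝ} (h : dist z z₀ ≤ 1) (w : ℝ × ℝ) {r : ℝ} (hr : 0 < r) :
    heatK z w r ≤ 2 * Real.exp (1 / (2 * r)) * heatK z₀ w (2 * r) := by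
  have h1 : |z.1 - z₀.1| ≤ 1 := by
    rw [← Real.dist_eq]; exact (le_max_left _ _).trans h
  have h2 : |z.2 - z₀.2| ≤ 1 := by
    rw [← Real.dist_eq]; exact (le_max_right _ _).trans h
  have h1' : (z.1 - z₀.1) ^ 2 ≤ 1 := by rw [← sq_abs]; exact pow_le_one₀ (abs_nonneg _) h1
  have h2' : (z.2 - z₀.2) ^ 2 ≤ 1 := by rw [← sq_abs]; exact pow_le_one₀ (abs_nonneg _) h2
  have key : -((z.1 - w.1) ^ 2 + (z.2 - w.2) ^ 2) / (4 * r) ≤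
      1 / (2 * r) + -((z₀.1 - w.1) ^ 2 + (z₀.2 - w.2) ^ 2) / (4 * (2 * r)) := by
    have e : 1 / (2 * r) + -((z₀.1 - w.1) ^ 2 + (z₀.2 - w.2) ^ 2) / (4 * (2 * r)) =
      (2 - ((z₀.1 - w.1) ^ 2 + (z₀.2 - w.2) ^ 2) / 2) / (4 * r) := by field_simp; ring
    rw [e]
    apply div_le_div_of_nonneg_right _ (by positivity)
    nlinarith [sq_nonneg ((z.1 - w.1) + (z.1 - z₀.1)), sq_nonneg ((z.2 - w.2) + (z.2 - z₀.2))]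
  unfold heatK heatKernel
  calc _ ≤ 1 / (4 * Real.pi * r) * Real.exp (1 / (2 * r) +
        -((z₀.1 - w.1) ^ 2 + (z₀.2 - w.2) ^ 2) / (4 * (2 * r))) := by gcongr
    _ = _ := by rw [Real.exp_add]; field_simp

theorem integrable_exp_sq (x : ℝ) {r : ℝ} (hr : 0 < r) :
    Integrable (fun x' => Real.exp (-(x - x') ^ 2 / (4 * r))) := by
  have := (integrable_exp_neg_mul_sq (b := 1 / (4 * r)) (by positivity)).comp_sub_left x
  refine this.congr (ae_of_all _ fun x' => ?_)
  simp only; congr 1; ring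

theorem lintegral_exp_sq (x : ℝ) {r : ℝ} (hr : 0 < r) :
    ∫⁻ x', ENNReal.ofReal (Real.exp (-(x - x') ^ 2 / (4 * r))) =
      ENNReal.ofReal (√(4 * Real.pi * r)) := by
  rw [← ofReal_integral_eq_lintegral_ofReal (integrable_exp_sq x hr)
    (ae_of_all _ fun _ => (Real.exp_pos _).le)]
  congr 1
  rw [integral_sub_left_eq_self (fun x' => Real.exp (-x' ^ 2 / (4 * r))) volume x]
  have := integral_gaussian (1 / (4 * r))
  rw [show Real.pi / (1 / (4 * r)) = 4 * Real.pi * r by field_simp] at this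
  rw [← this]
  congr 1; ext x'; congr 1; ring

/-- A measure on `ℝ²` against which the heat kernel has mass `O(1 + r^{-1/2})`, uniformly in its
centre. The exponent is what makes the Duhamel integral converge at `s = t`. -/
def HasHeatBound (ν : Measure (ℝ × ℝ)) (A : ℝ) : Prop :=
  0 ≤ A ∧ ∀ z r, 0 < r →
    ∫⁻ w, ENNReal.ofReal (heatK z w r) ∂ν ≤ ENNReal.ofReal (A * (1 + r ^ (-1 / 2 : ℝ)))

theorem lintegral_heatK_prod (m : Measure ℝ) [SFinite m] (z : ℝ × ℝ) {r : ℝ} (hr : 0 < r) :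
    ∫⁻ w, ENNReal.ofReal (heatK z w r) ∂(m.prod volume) =
      ENNReal.ofReal (1 / √(4 * Real.pi * r)) *
        ∫⁻ x, ENNReal.ofReal (Real.exp (-(z.1 - x) ^ 2 / (4 * r))) ∂m := by
  have hp : 0 < 4 * Real.pi * r := by positivity
  have e : ∀ w : ℝ × ℝ, ENNReal.ofReal (heatK z w r) = ENNReal.ofReal (1 / (4 * Real.pi * r)) *
      (ENNReal.ofReal (Real.exp (-(z.1 - w.1) ^ 2 / (4 * r))) *
        ENNReal.ofReal (Real.exp (-(z.2 - w.2) ^ 2 / (4 * r)))) := fun w => by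
    rw [heatK, heatKernel_eq_mul, ENNReal.ofReal_mul (by positivity),
      ENNReal.ofReal_mul (by positivity)]
  simp_rw [e]
  rw [lintegral_const_mul _ (by fun_prop),
    lintegral_prod_mul (f := fun x => ENNReal.ofReal (Real.exp (-(z.1 - x) ^ 2 / (4 * r))))
      (g := fun x => ENNReal.ofReal (Real.exp (-(z.2 - x) ^ 2 / (4 * r))))
      (by fun_prop) (by fun_prop), lintegral_exp_sq _ hr, mul_left_comm, mul_comm,
    ← ENNReal.ofReal_mul (by positivity)]
  congr 2
  rw [div_mul_eq_mul_div, one_mul, div_eq_div_iff hp.ne' (by positivity), one_mul,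
    Real.mul_self_sqrt hp.le]

theorem lintegral_heatK (z : ℝ × ℝ) {r : ℝ} (hr : 0 < r) :
    ∫⁻ w, ENNReal.ofReal (heatK z w r) = 1 := by
  have hp : 0 < 4 * Real.pi * r := by positivity
  rw [show (volume : Measure (ℝ × ℝ)) = volume.prod volume from rfl,
    lintegral_heatK_prod volume z hr, lintegral_exp_sq _ hr, ← ENNReal.ofReal_mul (by positivity),
    one_div, inv_mul_cancel₀ (by positivity), ENNReal.ofReal_one]

theorem integrable_heatK (z : ℝ × ℝ) {r : ℝ} (hr : 0 < r) :
    Integrable (fun w => heatK z w r) := by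
  refine ⟨Measurable.aestronglyMeasurable (by fun_prop), ?_⟩
  rw [hasFiniteIntegral_iff_ofReal (ae_of_all _ fun w => heatK_nonneg z w hr.le),
    lintegral_heatK z hr]
  exact ENNReal.one_lt_top

theorem integral_heatK (z : ℝ × ℝ) {r : ℝ} (hr : 0 < r) : ∫ w, heatK z w r = 1 := by
  rw [integral_eq_lintegral_of_nonneg_ae (ae_of_all _ fun w => heatK_nonneg z w hr.le)
    (Measurable.aestronglyMeasurable (by fun_prop)), lintegral_heatK z hr, ENNReal.toReal_one]

theorem hasHeatBound_volume : HasHeatBound volume 1 := by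
  refine ⟨zero_le_one, fun z r hr => ?_⟩
  rw [lintegral_heatK z hr, ← ENNReal.ofReal_one]
  apply ENNReal.ofReal_le_ofReal
  have := Real.rpow_nonneg hr.le (-1 / 2 : ℝ)
  linarith

/-- For a uniformly locally finite measure the one-dimensional Gaussian of width `√r` has mass
`O(√r / ρ)` at any scale `ρ ≤ √r`: the Gaussian is dominated by its average over intervals of
radius `ρ`, which turns the measure into Lebesgue measure. -/
theorem lintegral_exp_sq_le {m : Measure ℝ} [SFinite m] {ℓ C : ℝ}
    (hm : ∀ a, m (Icc a (a + ℓ)) ≤ ENNReal.ofReal C) (x : ℝ) {r ρ : ℝ} (hr : 0 < r)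
    (hρ : 0 < ρ) (hρr : ρ ≤ √r) (hρℓ : 2 * ρ ≤ ℓ) :
    ∫⁻ x', ENNReal.ofReal (Real.exp (-(x - x') ^ 2 / (4 * r))) ∂m ≤
      ENNReal.ofReal (C / ρ * √(8 * Real.pi * r)) := by
  set E : ℝ → ENNReal := fun y => ENNReal.ofReal (2 * Real.exp (-(x - y) ^ 2 / (4 * (2 * r))))
    with hE
  have hEm : Measurable E := by fun_prop
  have hρ2 : ρ ^ 2 ≤ r := by
    calc ρ ^ 2 ≤ (√r) ^ 2 := by gcongr
      _ = r := Real.sq_sqrt hr.le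
  let S : Set (ℝ × ℝ) := {p | |p.1 - p.2| ≤ ρ}
  have hS : MeasurableSet S := measurableSet_le (by fun_prop) (by fun_prop)
  have key : ∀ x', ENNReal.ofReal (2 * ρ) *
      ENNReal.ofReal (Real.exp (-(x - x') ^ 2 / (4 * r))) ≤
        ∫⁻ y, S.indicator (fun p => E p.2) (x', y) := fun x' => by
    calc _ = ∫⁻ y in Icc (x' - ρ) (x' + ρ),
          ENNReal.ofReal (Real.exp (-(x - x') ^ 2 / (4 * r))) := by
          rw [setLIntegral_const, Real.volume_Icc, mul_comm]; congr 2; ring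
      _ ≤ ∫⁻ y in Icc (x' - ρ) (x' + ρ), E y := by
          refine setLIntegral_mono hEm fun y hy => ENNReal.ofReal_le_ofReal ?_
          have hy' : (x' - y) ^ 2 ≤ r := by
            refine le_trans ?_ hρ2
            rw [← sq_abs (x' - y)]
            gcongr
            rw [abs_le]; constructor <;> linarith [hy.1, hy.2]
          have h3 : -(x - x') ^ 2 / (4 * r) ≤ 1 / 4 + -(x - y) ^ 2 / (4 * (2 * r)) := by
            have e : 1 / 4 + -(x - y) ^ 2 / (4 * (2 * r)) = (r - (x - y) ^ 2 / 2) / (4 * r) := by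
              field_simp; ring
            rw [e]
            apply div_le_div_of_nonneg_right _ (by positivity)
            nlinarith [sq_nonneg ((x - x') - (x' - y))]
          have h4 : Real.exp (1 / 4) ≤ 2 := by
            have h5 : Real.exp (1 / 4) ≤ 1 / (1 - 1 / 4) :=
              Real.exp_bound_div_one_sub_of_interval (by norm_num) (by norm_num)
            linarith [show (1 : ℝ) / (1 - 1 / 4) ≤ 2 by norm_num]
          calc _ ≤ Real.exp (1 / 4 + -(x - y) ^ 2 / (4 * (2 * r))) := Real.exp_le_exp.2 h3
            _ = Real.exp (1 / 4) * Real.exp (-(x - y) ^ 2 / (4 * (2 * r))) := Real.exp_add _ _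
            _ ≤ _ := by gcongr
      _ = _ := by
          rw [← lintegral_indicator measurableSet_Icc]
          refine lintegral_congr fun y => ?_
          have : y ∈ Icc (x' - ρ) (x' + ρ) ↔ (x', y) ∈ S := by
            simp only [S, mem_ofPred_eq, abs_le, mem_Icc]
            constructor <;> rintro ⟨h, h'⟩ <;> constructor <;> linarith
          by_cases h : y ∈ Icc (x' - ρ) (x' + ρ)
          · rw [indicator_of_mem h, indicator_of_mem (this.1 h)]
          · rw [indicator_of_notMem h, indicator_of_notMem (fun h' => h (this.2 h'))]
  -- integrate `key` against `m` and exchange the integrals; then `m` only sees short intervals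
  have tot : ENNReal.ofReal (2 * ρ) *
      ∫⁻ x', ENNReal.ofReal (Real.exp (-(x - x') ^ 2 / (4 * r))) ∂m ≤
        ENNReal.ofReal (2 * C * √(8 * Real.pi * r)) := by
    rw [← lintegral_const_mul _ (by fun_prop)]
    calc _ ≤ ∫⁻ x', (∫⁻ y, S.indicator (fun p => E p.2) (x', y)) ∂m := lintegral_mono key
      _ = ∫⁻ y, ∫⁻ x', S.indicator (fun p => E p.2) (x', y) ∂m := by
          apply lintegral_lintegral_swap
          exact ((hEm.comp measurable_snd).indicator hS).aemeasurable
      _ ≤ ∫⁻ y, E y * ENNReal.ofReal C := by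
          refine lintegral_mono fun y => ?_
          calc _ ≤ ∫⁻ x', (Icc (y - ρ) (y - ρ + ℓ)).indicator (fun _ => E y) x' ∂m := by
                refine lintegral_mono fun x' => ?_
                by_cases h : (x', y) ∈ S
                · rw [indicator_of_mem h, indicator_of_mem]
                  have := abs_le.1 (show |x' - y| ≤ ρ from h)
                  exact ⟨by linarith, by linarith⟩
                · rw [indicator_of_notMem h]; exact zero_le
            _ = E y * m (Icc (y - ρ) (y - ρ + ℓ)) := by
                rw [lintegral_indicator_const measurableSet_Icc]
            _ ≤ _ := by gcongr; exact hm _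
      _ = _ := by
          rw [lintegral_mul_const _ hEm, hE]
          simp_rw [ENNReal.ofReal_mul (zero_le_two (α := ℝ))]
          rw [lintegral_const_mul _ (by fun_prop), lintegral_exp_sq x (by positivity),
            ← ENNReal.ofReal_mul zero_le_two, ← ENNReal.ofReal_mul (by positivity)]
          congr 1
          rw [show 4 * Real.pi * (2 * r) = 8 * Real.pi * r by ring]
          ring
  rw [mul_comm, ← ENNReal.le_div_iff_mul_le (Or.inl (by simpa using hρ))
      (Or.inl ENNReal.ofReal_ne_top),
    ← ENNReal.ofReal_div_of_pos (by positivity)] at tot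
  refine tot.trans (ENNReal.ofReal_le_ofReal (le_of_eq ?_))
  field_simp

/-- The heat bound for `m ⊗ dy`: the Gaussian in `y` integrates to one, and the mass in `x` is
estimated at the scale `min (√r) (ℓ / 2)`. -/
theorem hasHeatBound_prod {m : Measure ℝ} [SFinite m] {ℓ C : ℝ} (hℓ : 0 < ℓ) (hC : 0 ≤ C)
    (hm : ∀ a, m (Icc a (a + ℓ)) ≤ ENNReal.ofReal C) :
    HasHeatBound (m.prod volume) (2 * C * (1 + 2 / ℓ)) := by
  refine ⟨by positivity, fun z r hr => ?_⟩
  have hr' : 0 < √r := Real.sqrt_pos.2 hr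
  -- the averaging scale: below the Gaussian width, and intervals of radius `ρ` fit into length `ℓ`
  set ρ := min (√r) (ℓ / 2) with hρdef
  have hρ : 0 < ρ := lt_min hr' (by positivity)
  rw [lintegral_heatK_prod m z hr]
  refine (mul_le_mul_right (lintegral_exp_sq_le hm z.1 hr hρ (min_le_left _ _)
    (by linarith [min_le_right (√r) (ℓ / 2)])) _).trans ?_
  rw [← ENNReal.ofReal_mul (by positivity)]
  apply ENNReal.ofReal_le_ofReal
  have h1 : √(8 * Real.pi * r) ≤ 2 * √(4 * Real.pi * r) := by
    rw [Real.sqrt_le_left (by positivity), mul_pow, Real.sq_sqrt (by positivity)]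
    nlinarith [Real.pi_pos, mul_pos Real.pi_pos hr]
  have h2 : 1 / ρ ≤ 1 / √r + 2 / ℓ := by
    rcases min_choice (√r) (ℓ / 2) with h | h
    · rw [hρdef, h]; have : 0 < 2 / ℓ := by positivity
      linarith
    · rw [hρdef, h]; have : 0 < 1 / √r := by positivity
      have e : 1 / (ℓ / 2) = 2 / ℓ := by field_simp
      linarith
  have h3 : r ^ (-1 / 2 : ℝ) = 1 / √r := by
    rw [Real.sqrt_eq_rpow, one_div, ← Real.rpow_neg hr.le]; norm_num
  have h4 : 0 < √(4 * Real.pi * r) := by positivity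
  calc _ ≤ 1 / √(4 * Real.pi * r) * (C / ρ * (2 * √(4 * Real.pi * r))) := by gcongr
    _ = 2 * C * (1 / ρ) := by field_simp
    _ ≤ 2 * C * (1 / √r + 2 / ℓ) := mul_le_mul_of_nonneg_left h2 (by positivity)
    _ ≤ _ := by
      rw [h3, mul_assoc (2 * C)]
      refine mul_le_mul_of_nonneg_left ?_ (mul_nonneg zero_le_two hC)
      have : 0 < 2 / ℓ * (1 / √r) := by positivity
      nlinarith

/-! ### Uniform local finiteness of the coefficient -/

theorem Lam.integral_two_periods {L α : ℝ} (hL : 0 < L) {b : ℝ → ℝ} (hb : b ∈ Lam L α) (a : ℝ) :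
    ∫ x in a..a + 2 * L, b x = 2 * (α * L) := by
  have hp : Function.Periodic b L := hb.2.2.1
  have h0 : ∫ x in (0 : ℝ)..0 + L, b x = α * L := by
    rw [zero_add, intervalIntegral.integral_of_le hL.le, ← integral_Ico_eq_integral_Ioc]
    exact hb.2.2.2
  have hi : ∀ p q, IntervalIntegrable b volume p q := fun p q =>
    hb.1.continuous.intervalIntegrable p q
  rw [← intervalIntegral.integral_add_adjacent_intervals (hi a (a + L)) (hi _ _),
    show a + 2 * L = (a + L) + L by ring, hp.intervalIntegral_add_eq a 0,
    hp.intervalIntegral_add_eq (a + L) 0, h0]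
  ring

/-- Members of the closure are uniformly locally finite: a bump function over one period tests
every approximating density by at most its mass over two periods. -/
theorem LamBar.measure_Icc_le {L α : ℝ} (hL : 0 < L) {μ : Measure ℝ}
    (hμ : μ ∈ LamBar L α) (a : ℝ) : μ (Icc a (a + L)) ≤ ENNReal.ofReal (2 * (α * L)) := by
  obtain ⟨hfin, b, hb, hlim⟩ := hμ
  let φ : ContDiffBump (a + L / 2) := ⟨L / 2, L, by positivity, by linarith⟩
  have hint : ∀ n, ∫ x, b n x * φ x ≤ 2 * (α * L) := fun n => by
    have hcb : Continuous (b n) := (hb n).1.continuous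
    have hsupp : ∀ x, x ∉ Ioc (a - L / 2) (a - L / 2 + 2 * L) → b n x * φ x = 0 := fun x hx => by
      have : φ x = 0 := by
        apply φ.zero_of_le_dist
        change L ≤ dist x (a + L / 2)
        rw [Real.dist_eq]
        by_contra! h
        rw [abs_lt] at h
        exact hx ⟨by linarith [h.1], by linarith [h.2]⟩
      rw [this, mul_zero]
    rw [← setIntegral_eq_integral_of_forall_compl_eq_zero hsupp,
      ← Lam.integral_two_periods hL (hb n) (a - L / 2),
      intervalIntegral.integral_of_le (by linarith)]
    have hφ : Continuous φ := φ.continuous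
    refine setIntegral_mono_on ((hcb.mul hφ).integrableOn_Icc.mono_set Ioc_subset_Icc_self)
      (hcb.integrableOn_Icc.mono_set Ioc_subset_Icc_self) measurableSet_Ioc fun x _ => ?_
    exact mul_le_of_le_one_right ((hb n).2.1 x) φ.le_one
  have hle : ∫ x, φ x ∂μ ≤ 2 * (α * L) :=
    le_of_tendsto' (hlim φ φ.contDiff φ.hasCompactSupport) hint
  have hφi : Integrable φ μ := φ.continuous.integrable_of_hasCompactSupport φ.hasCompactSupport
  calc μ (Icc a (a + L)) = ∫⁻ x, (Icc a (a + L)).indicator 1 x ∂μ := by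
        rw [lintegral_indicator_one measurableSet_Icc]
    _ ≤ ∫⁻ x, ENNReal.ofReal (φ x) ∂μ := by
        refine lintegral_mono fun x => ?_
        by_cases h : x ∈ Icc a (a + L)
        · rw [indicator_of_mem h, φ.one_of_mem_closedBall]
          · simp
          · rw [Metric.mem_closedBall, Real.dist_eq, abs_le]
            change -(L / 2) ≤ _ ∧ _ ≤ L / 2
            constructor <;> linarith [h.1, h.2]
        · rw [indicator_of_notMem h]; exact zero_le
    _ = ENNReal.ofReal (∫ x, φ x ∂μ) :=
        (ofReal_integral_eq_lintegral_ofReal hφi (ae_of_all _ fun x => φ.nonneg)).symm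
    _ ≤ _ := ENNReal.ofReal_le_ofReal hle

/-! ### The time profile -/

/-- The Laplace transform `∫₀^∞ e^{-λ r} (1 + r^{-1/2}) dr` of the time profile of the heat
bound. -/
noncomputable def laplaceWeight (l : ℝ) : ℝ := 1 / l + √(Real.pi / l)

theorem laplaceWeight_nonneg {l : ℝ} (hl : 0 < l) : 0 ≤ laplaceWeight l := by
  unfold laplaceWeight; positivity

theorem tendsto_laplaceWeight : Tendsto laplaceWeight atTop (𝓝 0) := by
  have h1 : Tendsto (fun l : ℝ => 1 / l) atTop (𝓝 0) := tendsto_const_nhds.div_atTop tendsto_id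
  have h2 : Tendsto (fun l : ℝ => √(Real.pi / l)) atTop (𝓝 0) := by
    have := (Real.continuous_sqrt.tendsto 0).comp
      ((tendsto_const_nhds (x := Real.pi)).div_atTop tendsto_id)
    simpa [Function.comp_def] using this
  have h := h1.add h2
  rw [add_zero] at h
  exact h

/-- Any prescribed constant is beaten by the Laplace transform at a large enough exponent. -/
theorem exists_laplaceWeight_le (K : ℝ) {ε : ℝ} (hε : 0 < ε) :
    ∃ l, 0 < l ∧ K * laplaceWeight l ≤ ε := by
  have h : Tendsto (fun l => K * laplaceWeight l) atTop (𝓝 0) := by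
    simpa using tendsto_laplaceWeight.const_mul K
  obtain ⟨l, hl, hl'⟩ := ((eventually_gt_atTop 0).and (h.eventually (Iic_mem_nhds hε))).exists
  exact ⟨l, hl, hl'⟩

theorem laplace_profile {l : ℝ} (hl : 0 < l) :
    IntegrableOn (fun r : ℝ => Real.exp (-(l * r)) * (1 + r ^ (-1 / 2 : ℝ))) (Ioi 0) ∧
    ∫ r in Ioi (0 : ℝ), Real.exp (-(l * r)) * (1 + r ^ (-1 / 2 : ℝ)) = laplaceWeight l := by
  have v1 := Real.integral_rpow_mul_exp_neg_mul_Ioi (a := 1) one_pos hl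
  have v2 := Real.integral_rpow_mul_exp_neg_mul_Ioi (a := 1 / 2) (by norm_num) hl
  rw [Real.Gamma_one, mul_one, Real.rpow_one] at v1
  rw [Real.Gamma_one_half_eq, ← Real.sqrt_eq_rpow,
    ← Real.sqrt_mul (by positivity)] at v2
  have hne1 : 1 / l ≠ 0 := by positivity
  have hne2 : √(1 / l * Real.pi) ≠ 0 := by positivity
  -- integrability is read off from the values, since a non-integrable function has integral `0`
  have i1 : IntegrableOn (fun t : ℝ => t ^ ((1 : ℝ) - 1) * Real.exp (-(l * t))) (Ioi 0) := by
    by_contra h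
    exact hne1 (by rw [← v1]; exact integral_undef h)
  have i2 : IntegrableOn (fun t : ℝ => t ^ ((1 / 2 : ℝ) - 1) * Real.exp (-(l * t))) (Ioi 0) := by
    by_contra h
    exact hne2 (by rw [← v2]; exact integral_undef h)
  have e : (fun r : ℝ => Real.exp (-(l * r)) * (1 + r ^ (-1 / 2 : ℝ))) =
      fun t => t ^ ((1 : ℝ) - 1) * Real.exp (-(l * t)) +
        t ^ ((1 / 2 : ℝ) - 1) * Real.exp (-(l * t)) := by
    ext t
    rw [show ((1 : ℝ) - 1) = 0 by norm_num, show ((1 / 2 : ℝ) - 1) = -1 / 2 by norm_num,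
      Real.rpow_zero]
    ring
  rw [e]
  refine ⟨i1.add i2, ?_⟩
  rw [integral_add i1 i2, v1, v2, laplaceWeight]
  congr 2; ring

theorem lintegral_Ioo_comp_sub (f : ℝ → ENNReal) (t : ℝ) :
    ∫⁻ s in Ioo 0 t, f (t - s) = ∫⁻ r in Ioo 0 t, f r := by
  rw [← lintegral_indicator measurableSet_Ioo, ← lintegral_indicator measurableSet_Ioo,
    ← lintegral_sub_left_eq_self _ t]
  refine lintegral_congr fun s => ?_
  by_cases h : s ∈ Ioo 0 t
  · rw [indicator_of_mem h, indicator_of_mem (show t - s ∈ Ioo 0 t from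
      ⟨by linarith [h.2], by linarith [h.1]⟩),
      sub_sub_cancel]
  · rw [indicator_of_notMem h, indicator_of_notMem]
    exact fun h' => h ⟨by linarith [h'.2], by linarith [h'.1]⟩

theorem integral_Ioo_comp_sub (f : ℝ → ℝ) (t : ℝ) :
    ∫ s in Ioo 0 t, f (t - s) = ∫ r in Ioo 0 t, f r := by
  rw [← integral_indicator measurableSet_Ioo, ← integral_indicator measurableSet_Ioo,
    ← integral_sub_left_eq_self _ volume t]
  refine integral_congr_ae (ae_of_all _ fun s => ?_)
  simp only
  by_cases h : s ∈ Ioo 0 t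
  · rw [indicator_of_mem h, indicator_of_mem (show t - s ∈ Ioo 0 t from
      ⟨by linarith [h.2], by linarith [h.1]⟩),
      sub_sub_cancel]
  · rw [indicator_of_notMem h, indicator_of_notMem]
    exact fun h' => h ⟨by linarith [h'.2], by linarith [h'.1]⟩

theorem lintegral_weight_le {l : ℝ} (hl : 0 < l) (t : ℝ) :
    ∫⁻ s in Ioo 0 t, ENNReal.ofReal (Real.exp (l * s) * (1 + (t - s) ^ (-1 / 2 : ℝ))) ≤
      ENNReal.ofReal (Real.exp (l * t) * laplaceWeight l) := by
  have h1 : ∀ s, ENNReal.ofReal (Real.exp (l * s) * (1 + (t - s) ^ (-1 / 2 : ℝ))) =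
      (fun r => ENNReal.ofReal (Real.exp (l * t)) *
        ENNReal.ofReal (Real.exp (-(l * r)) * (1 + r ^ (-1 / 2 : ℝ)))) (t - s) := fun s => by
    simp only
    rw [← ENNReal.ofReal_mul (Real.exp_pos _).le, ← mul_assoc, ← Real.exp_add]
    congr 4; ring
  simp_rw [h1]
  rw [lintegral_Ioo_comp_sub (fun r => ENNReal.ofReal (Real.exp (l * t)) *
        ENNReal.ofReal (Real.exp (-(l * r)) * (1 + r ^ (-1 / 2 : ℝ)))),
    lintegral_const_mul _ (by fun_prop), ENNReal.ofReal_mul (Real.exp_pos _).le]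
  gcongr
  rw [← (laplace_profile hl).2, ofReal_integral_eq_lintegral_ofReal (laplace_profile hl).1]
  · exact lintegral_mono_set Ioo_subset_Ioi_self
  · filter_upwards [ae_restrict_mem measurableSet_Ioi] with r hr
    have := Real.rpow_nonneg (le_of_lt hr) (-1 / 2 : ℝ)
    simp only [Pi.zero_apply]
    positivity

/-! ### The heat evolution of the initial data -/

/-- The heat evolution of `φ`, in the scaled form `∫ G(y, 1) φ(z + √t y) dy`, which makes sense
(and is continuous) for all real `t` and gives back `φ` for `t ≤ 0`. -/
noncomputable def heatEvol (φ : ℝ × ℝ → ℝ) (z : ℝ × ℝ) (t : ℝ) : ℝ :=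
  ∫ y : ℝ × ℝ, heatK 0 y 1 * φ (z + √t • y)

theorem heatEvol_of_nonpos (φ : ℝ × ℝ → ℝ) (z : ℝ × ℝ) {t : ℝ} (ht : t ≤ 0) :
    heatEvol φ z t = φ z := by
  unfold heatEvol
  simp only [Real.sqrt_eq_zero_of_nonpos ht, zero_smul, add_zero]
  rw [integral_mul_const, integral_heatK 0 one_pos, one_mul]

theorem heatK_scale (z y : ℝ × ℝ) {t : ℝ} (ht : 0 < t) :
    heatK z (z + √t • y) t = t⁻¹ * heatK 0 y 1 := by
  unfold heatK heatKernel
  have e : -((z.1 - (z + √t • y).1) ^ 2 + (z.2 - (z + √t • y).2) ^ 2) / (4 * t) =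
      -(((0 : ℝ × ℝ).1 - y.1) ^ 2 + ((0 : ℝ × ℝ).2 - y.2) ^ 2) / (4 * 1) := by
    have hs : √t ^ 2 = t := Real.sq_sqrt ht.le
    simp only [Prod.fst_add, Prod.snd_add, Prod.smul_fst, Prod.smul_snd, smul_eq_mul,
      Prod.fst_zero, Prod.snd_zero]
    rw [div_eq_div_iff (by positivity) (by norm_num)]
    linear_combination (-4 * (y.1 ^ 2 + y.2 ^ 2)) * hs
  rw [e]
  field_simp

/-- The scaled form agrees with the heat integral through the substitution `w = z + √t y`. -/
theorem integral_heatK_mul_eq (φ : ℝ × ℝ → ℝ) (z : ℝ × ℝ) {t : ℝ} (ht : 0 < t) :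
    ∫ w, heatK z w t * φ w = heatEvol φ z t := by
  have h1 := Measure.integral_comp_smul (volume : Measure (ℝ × ℝ))
    (fun y => heatK z (z + y) t * φ (z + y)) (√t)
  rw [integral_add_left_eq_self (fun y => heatK z y t * φ y) z] at h1
  have hd : Module.finrank ℝ (ℝ × ℝ) = 2 := by simp
  rw [hd, Real.sq_sqrt ht.le, abs_of_pos (by positivity), smul_eq_mul] at h1
  have h2 : ∀ y, heatK z (z + √t • y) t * φ (z + √t • y) =
      t⁻¹ * (heatK 0 y 1 * φ (z + √t • y)) := fun y => by rw [heatK_scale z y ht]; ring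
  simp_rw [h2] at h1
  rw [integral_const_mul] at h1
  exact (mul_left_cancel₀ (by positivity) h1).symm

/-- The scaled form of the heat evolution is jointly continuous, also when the evolved function
depends continuously on a parameter. -/
theorem continuous_heatEvol_param {X : Type*} [TopologicalSpace X] [FirstCountableTopology X]
    {Φ : X → ℝ × ℝ → ℝ} (hΦ : Continuous fun p : X × (ℝ × ℝ) => Φ p.1 p.2) {B : ℝ}
    (hB : ∀ x w, |Φ x w| ≤ B) {z : X → ℝ × ℝ} {t : X → ℝ} (hz : Continuous z) (ht : Continuous t) :
    Continuous fun x => heatEvol (Φ x) (z x) (t x) := by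
  unfold heatEvol
  have hγ : Continuous fun y : ℝ × ℝ => heatK 0 y 1 :=
    (continuous_heatKernel 1).comp (by fun_prop : Continuous fun y : ℝ × ℝ =>
      ((0 : ℝ × ℝ).1 - y.1, (0 : ℝ × ℝ).2 - y.2))
  refine continuous_of_dominated (bound := fun y => heatK 0 y 1 * B) (fun x => ?_) (fun x => ?_)
    ((integrable_heatK 0 one_pos).mul_const B) (ae_of_all _ fun y => ?_)
  · have : Continuous (Φ x) := hΦ.comp (Continuous.prodMk_right x)
    exact (hγ.mul (this.comp (by fun_prop))).aestronglyMeasurable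
  · refine ae_of_all _ fun y => ?_
    rw [Real.norm_eq_abs, abs_mul, abs_of_nonneg (heatK_nonneg _ _ zero_le_one)]
    exact mul_le_mul_of_nonneg_left (hB _ _) (heatK_nonneg _ _ zero_le_one)
  · exact continuous_const.mul (hΦ.comp (by fun_prop :
      Continuous fun x => (x, z x + √(t x) • y)))

theorem continuous_heatEvol (φ : (ℝ × ℝ) →ᵇ ℝ) :
    Continuous fun p : (ℝ × ℝ) × ℝ => heatEvol φ p.1 p.2 :=
  continuous_heatEvol_param (Φ := fun _ => φ) (by fun_prop) (B := ‖φ‖)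
    (fun _ w => φ.norm_coe_le_norm w) continuous_fst continuous_snd

theorem abs_heatEvol_le {φ : ℝ × ℝ → ℝ} {B : ℝ} (hB : ∀ w, |φ w| ≤ B) (z : ℝ × ℝ) (t : ℝ) :
    |heatEvol φ z t| ≤ B := by
  have h := norm_integral_le_of_norm_le (f := fun y => heatK 0 y 1 * φ (z + √t • y))
    ((integrable_heatK 0 one_pos).mul_const B) (ae_of_all _ fun y => by
      rw [Real.norm_eq_abs, abs_mul, abs_of_nonneg (heatK_nonneg _ _ zero_le_one)]
      exact mul_le_mul_of_nonneg_left (hB _) (heatK_nonneg _ _ zero_le_one))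
  rwa [integral_mul_const, integral_heatK 0 one_pos, one_mul] at h

theorem integrable_heatK_mul {φ : ℝ × ℝ → ℝ} (hφ : Continuous φ) {B : ℝ} (hB : ∀ w, |φ w| ≤ B)
    (z : ℝ × ℝ) {t : ℝ} (ht : 0 < t) : Integrable fun w => heatK z w t * φ w :=
  (integrable_heatK z ht).mul_bdd hφ.aestronglyMeasurable (ae_of_all _ hB)

theorem heatEvol_sub {φ ψ : ℝ × ℝ → ℝ} (z : ℝ × ℝ) (hφ : Continuous φ) (hψ : Continuous ψ)
    {B : ℝ} (hB : ∀ w, |φ w| ≤ B) (hB' : ∀ w, |ψ w| ≤ B) {t : ℝ} (ht : 0 < t) :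
    heatEvol φ z t - heatEvol ψ z t = heatEvol (fun w => φ w - ψ w) z t := by
  rw [← integral_heatK_mul_eq _ z ht, ← integral_heatK_mul_eq _ z ht,
    ← integral_heatK_mul_eq _ z ht, ← integral_sub (integrable_heatK_mul hφ hB z ht)
      (integrable_heatK_mul hψ hB' z ht)]
  simp_rw [mul_sub]

/-! ### The Duhamel integral -/

section Duhamel

variable {ν : Measure (ℝ × ℝ)} {A : ℝ}

theorem HasHeatBound.integrable_heatK (hν : HasHeatBound ν A) (z : ℝ × ℝ) {r : ℝ} (hr : 0 < r) :
    Integrable (fun w => heatK z w r) ν := by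
  refine ⟨Measurable.aestronglyMeasurable (by fun_prop), ?_⟩
  rw [hasFiniteIntegral_iff_ofReal (ae_of_all _ fun w => heatK_nonneg z w hr.le)]
  exact (hν.2 z r hr).trans_lt ENNReal.ofReal_lt_top

theorem HasHeatBound.integral_heatK_le (hν : HasHeatBound ν A) (z : ℝ × ℝ) {r : ℝ} (hr : 0 < r) :
    ∫ w, heatK z w r ∂ν ≤ A * (1 + r ^ (-1 / 2 : ℝ)) := by
  have h0 : 0 ≤ A * (1 + r ^ (-1 / 2 : ℝ)) := by
    have := Real.rpow_nonneg hr.le (-1 / 2 : ℝ)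
    have := hν.1
    positivity
  rw [integral_eq_lintegral_of_nonneg_ae (ae_of_all _ fun w => heatK_nonneg z w hr.le)
    (Measurable.aestronglyMeasurable (by fun_prop))]
  exact ENNReal.toReal_le_of_le_ofReal h0 (hν.2 z r hr)

/-- The measure `ds ν(dw)` on `(0, t) × ℝ²`. -/
noncomputable abbrev spaceTime (ν : Measure (ℝ × ℝ)) (t : ℝ) : Measure (ℝ × (ℝ × ℝ)) :=
  (volume.restrict (Ioo 0 t)).prod ν

theorem spaceTime_eq_restrict (ν : Measure (ℝ × ℝ)) [SFinite ν] (t : ℝ) :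
    spaceTime ν t = (volume.prod ν).restrict (Ioo 0 t ×ˢ univ) := by
  rw [← Measure.prod_restrict, Measure.restrict_univ]

theorem ae_spaceTime [SFinite ν] (t : ℝ) : ∀ᵐ p ∂(spaceTime ν t), p.1 ∈ Ioo 0 t := by
  rw [spaceTime_eq_restrict]
  filter_upwards [ae_restrict_mem (measurableSet_Ioo.prod MeasurableSet.univ)] with p hp
  exact hp.1

theorem lintegral_spaceTime_exp_le [SFinite ν] (hν : HasHeatBound ν A) (z : ℝ × ℝ) (t : ℝ) {l : ℝ}
    (hl : 0 < l) :
    ∫⁻ p, ENNReal.ofReal (heatK z p.2 (t - p.1) * Real.exp (l * p.1)) ∂(spaceTime ν t) ≤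
      ENNReal.ofReal (A * laplaceWeight l * Real.exp (l * t)) := by
  rw [lintegral_prod _ (Measurable.aemeasurable (by fun_prop))]
  calc _ ≤ ∫⁻ s in Ioo 0 t, ENNReal.ofReal A *
        ENNReal.ofReal (Real.exp (l * s) * (1 + (t - s) ^ (-1 / 2 : ℝ))) := by
        refine setLIntegral_mono (by fun_prop) fun s hs => ?_
        have hr : 0 < t - s := sub_pos.2 hs.2
        have e : ∀ w, ENNReal.ofReal (heatK z w (t - s) * Real.exp (l * s)) =
            ENNReal.ofReal (heatK z w (t - s)) * ENNReal.ofReal (Real.exp (l * s)) := fun w =>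
          ENNReal.ofReal_mul (heatK_nonneg z w hr.le)
        simp_rw [e]
        rw [lintegral_mul_const _ (by fun_prop)]
        refine (mul_le_mul_left (hν.2 z _ hr) _).trans_eq ?_
        rw [ENNReal.ofReal_mul hν.1, ENNReal.ofReal_mul (Real.exp_pos _).le]
        ring
    _ = ENNReal.ofReal A * ∫⁻ s in Ioo 0 t,
        ENNReal.ofReal (Real.exp (l * s) * (1 + (t - s) ^ (-1 / 2 : ℝ))) := by
        rw [lintegral_const_mul _ (by fun_prop)]
    _ ≤ ENNReal.ofReal A * ENNReal.ofReal (Real.exp (l * t) * laplaceWeight l) :=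
        mul_le_mul_right (lintegral_weight_le hl t) _
    _ = _ := by rw [← ENNReal.ofReal_mul hν.1]; congr 1; ring

theorem integrable_spaceTime_exp [SFinite ν] (hν : HasHeatBound ν A) (z : ℝ × ℝ) (t : ℝ) {l : ℝ}
    (hl : 0 < l) :
    Integrable (fun p : ℝ × (ℝ × ℝ) => heatK z p.2 (t - p.1) * Real.exp (l * p.1))
      (spaceTime ν t) := by
  refine ⟨Measurable.aestronglyMeasurable (by fun_prop), ?_⟩
  rw [hasFiniteIntegral_iff_ofReal]
  · exact (lintegral_spaceTime_exp_le hν z t hl).trans_lt ENNReal.ofReal_lt_top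
  · filter_upwards [ae_spaceTime t] with p hp
    exact mul_nonneg (heatK_nonneg _ _ (sub_nonneg.2 hp.2.le)) (Real.exp_pos _).le

theorem integral_spaceTime_exp_le [SFinite ν] (hν : HasHeatBound ν A) (z : ℝ × ℝ) (t : ℝ) {l : ℝ}
    (hl : 0 < l) :
    ∫ p, heatK z p.2 (t - p.1) * Real.exp (l * p.1) ∂(spaceTime ν t) ≤
      A * laplaceWeight l * Real.exp (l * t) := by
  rw [integral_eq_lintegral_of_nonneg_ae]
  · refine ENNReal.toReal_le_of_le_ofReal ?_ (lintegral_spaceTime_exp_le hν z t hl)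
    exact mul_nonneg (mul_nonneg hν.1 (laplaceWeight_nonneg hl)) (Real.exp_pos _).le
  · filter_upwards [ae_spaceTime t] with p hp
    exact mul_nonneg (heatK_nonneg _ _ (sub_nonneg.2 hp.2.le)) (Real.exp_pos _).le
  · exact Measurable.aestronglyMeasurable (by fun_prop)

theorem norm_heatK_mul_le {h : ℝ × ℝ → ℝ → ℝ} {B l t : ℝ} (z : ℝ × ℝ)
    (hh : ∀ w, ∀ s ∈ Ioo 0 t, |h w s| ≤ B * Real.exp (l * s)) {p : ℝ × (ℝ × ℝ)}
    (hp : p.1 ∈ Ioo 0 t) :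
    ‖heatK z p.2 (t - p.1) * h p.2 p.1‖ ≤ B * (heatK z p.2 (t - p.1) * Real.exp (l * p.1)) := by
  have h0 := heatK_nonneg z p.2 (sub_nonneg.2 hp.2.le)
  rw [Real.norm_eq_abs, abs_mul, abs_of_nonneg h0]
  calc _ ≤ heatK z p.2 (t - p.1) * (B * Real.exp (l * p.1)) :=
        mul_le_mul_of_nonneg_left (hh _ _ hp) h0
    _ = _ := by ring

theorem integrable_spaceTime [SFinite ν] (hν : HasHeatBound ν A) {h : ℝ × ℝ → ℝ → ℝ} {B l t : ℝ}
    (hl : 0 < l)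
    (hm : AEStronglyMeasurable (fun p : ℝ × (ℝ × ℝ) => h p.2 p.1) (spaceTime ν t))
    (hh : ∀ w, ∀ s ∈ Ioo 0 t, |h w s| ≤ B * Real.exp (l * s)) (z : ℝ × ℝ) :
    Integrable (fun p : ℝ × (ℝ × ℝ) => heatK z p.2 (t - p.1) * h p.2 p.1) (spaceTime ν t) := by
  refine ((integrable_spaceTime_exp hν z t hl).const_mul B).mono'
    ((Measurable.aestronglyMeasurable (by fun_prop)).mul hm) ?_
  filter_upwards [ae_spaceTime t] with p hp using norm_heatK_mul_le z hh hp

/-- The basic estimate: a source growing like `B e^{λ s}` has a Duhamel integral bounded by a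
small multiple of `B e^{λ t}` when `λ` is large. -/
theorem abs_integral_spaceTime_le [SFinite ν] (hν : HasHeatBound ν A) {h : ℝ × ℝ → ℝ → ℝ}
    {B l t : ℝ} (hB : 0 ≤ B) (hl : 0 < l)
    (hh : ∀ w, ∀ s ∈ Ioo 0 t, |h w s| ≤ B * Real.exp (l * s)) (z : ℝ × ℝ) :
    |∫ p, heatK z p.2 (t - p.1) * h p.2 p.1 ∂(spaceTime ν t)| ≤
      B * (A * laplaceWeight l * Real.exp (l * t)) := by
  have := norm_integral_le_of_norm_le (f := fun p : ℝ × (ℝ × ℝ) =>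
    heatK z p.2 (t - p.1) * h p.2 p.1) ((integrable_spaceTime_exp hν z t hl).const_mul B) (by
      filter_upwards [ae_spaceTime t] with p hp using norm_heatK_mul_le z hh hp)
  rw [integral_const_mul] at this
  exact this.trans (mul_le_mul_of_nonneg_left (integral_spaceTime_exp_le hν z t hl) hB)

/-- The Duhamel integral `∫₀ᵗ ∫ G(z - w, t - s) h(w, s) ν(dw) ds` of a source `h`. -/
noncomputable def duhamel (ν : Measure (ℝ × ℝ)) (h : ℝ × ℝ → ℝ → ℝ) (z : ℝ × ℝ) (t : ℝ) : ℝ :=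
  ∫ s in Ioo 0 t, ∫ w, heatK z w (t - s) * h w s ∂ν

theorem duhamel_eq_integral [SFinite ν] {h : ℝ × ℝ → ℝ → ℝ} {z : ℝ × ℝ} {t : ℝ}
    (hi : Integrable (fun p : ℝ × (ℝ × ℝ) => heatK z p.2 (t - p.1) * h p.2 p.1)
      (spaceTime ν t)) :
    duhamel ν h z t = ∫ p, heatK z p.2 (t - p.1) * h p.2 p.1 ∂(spaceTime ν t) :=
  (integral_prod _ hi).symm

theorem duhamel_of_nonpos (ν : Measure (ℝ × ℝ)) (h : ℝ × ℝ → ℝ → ℝ) (z : ℝ × ℝ) {t : ℝ}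
    (ht : t ≤ 0) : duhamel ν h z t = 0 := by
  rw [duhamel, Ioo_eq_empty (not_lt.2 ht), Measure.restrict_empty, integral_zero_measure]

section Continuity

variable {h : ℝ × ℝ → ℝ → ℝ} {B : ℝ}

/-- The contribution to the Duhamel integral at time `t` of the sources at time `t - r`. -/
noncomputable def duhamelLayer (ν : Measure (ℝ × ℝ)) (h : ℝ × ℝ → ℝ → ℝ) (z : ℝ × ℝ) (t r : ℝ) :
    ℝ :=
  ∫ w, heatK z w r * h w (t - r) ∂ν

theorem duhamel_eq_layer (h : ℝ × ℝ → ℝ → ℝ) (z : ℝ × ℝ) (t : ℝ) :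
    duhamel ν h z t = ∫ r, (Ioo 0 t).indicator (duhamelLayer ν h z t) r := by
  rw [integral_indicator measurableSet_Ioo, ← integral_Ioo_comp_sub, duhamel]
  simp only [duhamelLayer, sub_sub_cancel]

theorem measurable_duhamelLayer [SFinite ν]
    (hc : Continuous fun p : (ℝ × ℝ) × ℝ => h p.1 p.2) (z : ℝ × ℝ) (t : ℝ) :
    StronglyMeasurable (duhamelLayer ν h z t) := by
  have hm : Measurable fun p : ℝ × (ℝ × ℝ) => heatK z p.2 p.1 * h p.2 (t - p.1) := by
    refine Measurable.mul (by fun_prop) ?_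
    exact hc.measurable.comp (f := fun p : ℝ × (ℝ × ℝ) => (p.2, t - p.1)) (by fun_prop)
  exact hm.stronglyMeasurable.integral_prod_right'

theorem abs_duhamelLayer_le (hν : HasHeatBound ν A) (hB : ∀ w s, |h w s| ≤ B) (z : ℝ × ℝ) (t : ℝ)
    {r : ℝ} (hr : 0 < r) : |duhamelLayer ν h z t r| ≤ B * (A * (1 + r ^ (-1 / 2 : ℝ))) := by
  have hB0 : 0 ≤ B := (abs_nonneg _).trans (hB 0 0)
  have := norm_integral_le_of_norm_le (f := fun w => heatK z w r * h w (t - r))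
    ((hν.integrable_heatK z hr).const_mul B) (ae_of_all _ fun w => by
      rw [Real.norm_eq_abs, abs_mul, abs_of_nonneg (heatK_nonneg z w hr.le), mul_comm B]
      exact mul_le_mul_of_nonneg_left (hB _ _) (heatK_nonneg z w hr.le))
  rw [integral_const_mul] at this
  exact this.trans (mul_le_mul_of_nonneg_left (hν.integral_heatK_le z hr) hB0)

theorem continuous_duhamelLayer (hν : HasHeatBound ν A)
    (hc : Continuous fun p : (ℝ × ℝ) × ℝ => h p.1 p.2) (hB : ∀ w s, |h w s| ≤ B) {r : ℝ}
    (hr : 0 < r) : Continuous fun p : (ℝ × ℝ) × ℝ => duhamelLayer ν h p.1 p.2 r := by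
  have hB0 : 0 ≤ B := (abs_nonneg _).trans (hB 0 0)
  have hk : Continuous fun p : (ℝ × ℝ) × (ℝ × ℝ) => heatK p.1 p.2 r :=
    (continuous_heatKernel r).comp (by fun_prop :
      Continuous fun p : (ℝ × ℝ) × (ℝ × ℝ) => (p.1.1 - p.2.1, p.1.2 - p.2.2))
  rw [continuous_iff_continuousAt]
  rintro ⟨z₀, t₀⟩
  refine continuousAt_of_dominated
    (bound := fun w => 2 * Real.exp (1 / (2 * r)) * heatK z₀ w (2 * r) * B) ?_ ?_ ?_ ?_
  · refine Eventually.of_forall fun p => Continuous.aestronglyMeasurable ?_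
    exact (hk.comp (Continuous.prodMk_right p.1)).mul
      (hc.comp (by fun_prop : Continuous fun w : ℝ × ℝ => (w, p.2 - r)))
  · have : ∀ᶠ p : (ℝ × ℝ) × ℝ in 𝓝 (z₀, t₀), p.1 ∈ Metric.closedBall z₀ 1 :=
      continuous_fst.continuousAt.eventually_mem (Metric.closedBall_mem_nhds _ one_pos)
    filter_upwards [this] with p hp
    refine ae_of_all _ fun w => ?_
    rw [Real.norm_eq_abs, abs_mul, abs_of_nonneg (heatK_nonneg _ w hr.le)]
    exact mul_le_mul (heatK_le_of_near hp w hr) (hB _ _) (abs_nonneg _)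
      ((heatK_nonneg _ w hr.le).trans (heatK_le_of_near hp w hr))
  · exact ((hν.integrable_heatK z₀ (by positivity)).const_mul _).mul_const _
  · refine ae_of_all _ fun w => Continuous.continuousAt ?_
    exact (hk.comp (by fun_prop : Continuous fun p : (ℝ × ℝ) × ℝ => (p.1, w))).mul
      (hc.comp (by fun_prop : Continuous fun p : (ℝ × ℝ) × ℝ => (w, p.2 - r)))

/-- The Duhamel integral of a bounded continuous source is jointly continuous: in the variable
`r = t - s` the integrand at a fixed `r` is continuous in `(z, t)` away from `t = r`, and it is
dominated by the integrable profile `1 + r^{-1/2}`. -/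
theorem continuous_duhamel [SFinite ν] (hν : HasHeatBound ν A)
    (hc : Continuous fun p : (ℝ × ℝ) × ℝ => h p.1 p.2) (hB : ∀ w s, |h w s| ≤ B) :
    Continuous fun p : (ℝ × ℝ) × ℝ => duhamel ν h p.1 p.2 := by
  have hB0 : 0 ≤ B := (abs_nonneg _).trans (hB 0 0)
  have hA0 := hν.1
  simp_rw [duhamel_eq_layer]
  rw [continuous_iff_continuousAt]
  rintro ⟨z₀, t₀⟩
  refine continuousAt_of_dominated (bound := (Ioi 0).indicator fun r : ℝ =>
    B * A * Real.exp (t₀ + 1) * (Real.exp (-(1 * r)) * (1 + r ^ (-1 / 2 : ℝ)))) ?_ ?_ ?_ ?_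
  · exact Eventually.of_forall fun p =>
      ((measurable_duhamelLayer hc p.1 p.2).indicator measurableSet_Ioo).aestronglyMeasurable
  · have : ∀ᶠ p : (ℝ × ℝ) × ℝ in 𝓝 (z₀, t₀), p.2 ∈ Iio (t₀ + 1) :=
      continuous_snd.continuousAt.eventually_mem (Iio_mem_nhds (by simp))
    filter_upwards [this] with p hp
    refine ae_of_all _ fun r => ?_
    by_cases hr : r ∈ Ioo 0 p.2
    · rw [indicator_of_mem hr, indicator_of_mem (show r ∈ Ioi 0 from hr.1)]
      refine (abs_duhamelLayer_le hν hB _ _ hr.1).trans ?_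
      have hp0 := Real.rpow_nonneg hr.1.le (-1 / 2 : ℝ)
      have h1 : 1 ≤ Real.exp (t₀ + 1) * Real.exp (-(1 * r)) := by
        rw [← Real.exp_add, Real.one_le_exp_iff]
        linarith [hr.2, show p.2 < t₀ + 1 from hp]
      calc B * (A * (1 + r ^ (-1 / 2 : ℝ))) = 1 * (B * A * (1 + r ^ (-1 / 2 : ℝ))) := by ring
        _ ≤ (Real.exp (t₀ + 1) * Real.exp (-(1 * r))) * (B * A * (1 + r ^ (-1 / 2 : ℝ))) :=
          mul_le_mul_of_nonneg_right h1 (by positivity)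
        _ = _ := by ring
    · rw [indicator_of_notMem hr, norm_zero]
      refine indicator_nonneg (fun r hr => ?_) r
      have hp0 := Real.rpow_nonneg (le_of_lt hr) (-1 / 2 : ℝ)
      positivity
  · rw [integrable_indicator_iff measurableSet_Ioi]
    exact (laplace_profile one_pos).1.const_mul _
  · have hne : ∀ᵐ r : ℝ, r ≠ t₀ := by simp [ae_iff]
    filter_upwards [hne] with r hr
    rcases le_or_gt r 0 with h0 | h0
    · have : (fun p : (ℝ × ℝ) × ℝ => (Ioo 0 p.2).indicator (duhamelLayer ν h p.1 p.2) r) =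
          fun _ => 0 := funext fun p => indicator_of_notMem (fun h' => not_lt.2 h0 h'.1) _
      rw [this]
      exact continuousAt_const
    rcases lt_or_gt_of_ne hr with h1 | h1
    · refine (continuous_duhamelLayer hν hc hB h0).continuousAt.congr ?_
      have : ∀ᶠ p : (ℝ × ℝ) × ℝ in 𝓝 (z₀, t₀), p.2 ∈ Ioi r :=
        continuous_snd.continuousAt.eventually_mem (Ioi_mem_nhds h1)
      filter_upwards [this] with p hp
      exact (indicator_of_mem (show r ∈ Ioo 0 p.2 from ⟨h0, hp⟩) _).symm
    · refine (continuousAt_const (y := (0 : ℝ))).congr ?_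
      have : ∀ᶠ p : (ℝ × ℝ) × ℝ in 𝓝 (z₀, t₀), p.2 ∈ Iio r :=
        continuous_snd.continuousAt.eventually_mem (Iio_mem_nhds h1)
      filter_upwards [this] with p hp
      exact (indicator_of_notMem (fun h' : r ∈ Ioo 0 p.2 => lt_asymm h'.2 hp) _).symm

end Continuity

end Duhamel

/-! ### Truncation, stability and global solutions for bounded Lipschitz nonlinearities -/

/-- The nonlinearity `f`, frozen outside `[-M, M]`. -/
def trunc (f : ℝ → ℝ) (M : ℝ) (x : ℝ) : ℝ := f (max (-M) (min x M))

theorem trunc_eq (f : ℝ → ℝ) {M x : ℝ} (hx : |x| ≤ M) : trunc f M x = f x := by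
  rw [abs_le] at hx
  rw [trunc, min_eq_left hx.2, max_eq_right hx.1]

theorem exists_lipschitz_bounded_trunc {f : ℝ → ℝ} (hf : LocallyLipschitz f) {M : ℝ}
    (hM : 0 ≤ M) : ∃ K B, LipschitzWith K (trunc f M) ∧ ∀ x, |trunc f M x| ≤ B := by
  obtain ⟨K, hK⟩ := (hf.locallyLipschitzOn (s := Icc (-M) M)).exists_lipschitzOnWith_of_compact
    isCompact_Icc
  obtain ⟨B, hB⟩ := (isCompact_Icc (a := -M) (b := M)).exists_bound_of_continuousOn
    hf.continuous.continuousOn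
  have hmem : ∀ x, max (-M) (min x M) ∈ Icc (-M) M := fun x =>
    ⟨le_max_left _ _, max_le (by linarith) (min_le_right _ _)⟩
  refine ⟨K, B, ?_, fun x => hB _ (hmem x)⟩
  have hc : LipschitzWith 1 fun x : ℝ => max (-M) (min x M) :=
    (LipschitzWith.id.min_const M).const_max (-M)
  have := hK.comp hc.lipschitzOnWith (s := univ) (fun x _ => hmem x)
  rw [mul_one, lipschitzOnWith_univ] at this
  exact this

theorem exists_common_lipschitz_trunc {f g : ℝ → ℝ} (hf : LocallyLipschitz f)
    (hg : LocallyLipschitz g) {M : ℝ} (hM : 0 ≤ M) :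
    ∃ (K : NNReal) (B : ℝ), 0 ≤ B ∧ (LipschitzWith K (trunc f M) ∧ LipschitzWith K (trunc g M)) ∧
      (∀ x, |trunc f M x| ≤ B) ∧ ∀ x, |trunc g M x| ≤ B := by
  obtain ⟨K, B, h1, h2⟩ := exists_lipschitz_bounded_trunc hf hM
  obtain ⟨K', B', h1', h2'⟩ := exists_lipschitz_bounded_trunc hg hM
  refine ⟨max K K', max B B', ((abs_nonneg _).trans (h2 0)).trans (le_max_left _ _),
    ⟨h1.weaken (le_max_left _ _), h1'.weaken (le_max_right _ _)⟩,
    fun x => (h2 x).trans (le_max_left _ _), fun x => (h2' x).trans (le_max_right _ _)⟩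

theorem mem_timeInterval_of_le {T : EReal} {s t : ℝ} (ht : t ∈ timeInterval T) (hs : 0 < s)
    (hst : s ≤ t) : s ∈ timeInterval T :=
  ⟨hs, (EReal.coe_le_coe_iff.2 hst).trans_lt ht.2⟩

theorem mem_timeInterval_coe {s t : ℝ} : s ∈ timeInterval (t : EReal) ↔ s ∈ Ioo 0 t := by
  simp [timeInterval]

theorem exists_gt_mem_timeInterval {T : EReal} {t : ℝ} (ht : t ∈ timeInterval T) :
    ∃ τ ∈ timeInterval T, t < τ := by
  obtain ⟨q, hq1, hq2⟩ := EReal.lt_iff_exists_real_btwn.1 ht.2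
  have := EReal.coe_lt_coe_iff.1 hq1
  exact ⟨q, ⟨ht.1.trans this, hq2⟩, this⟩

section

variable {f g f' g' : ℝ → ℝ} {μ : Measure ℝ} {φ ψ : ℝ × ℝ → ℝ} {S T : EReal}
  {u v : ℝ × ℝ → ℝ → ℝ}

/-- A bounded mild solution stays one on a shorter interval and for nonlinearities that agree
with the original ones on its values. -/
theorem IsBoundedMildSolution.congr [SFinite μ] (h : IsBoundedMildSolution f g μ φ T u)
    (hS : 0 < S) (hST : S ≤ T) (hf : ∀ z, ∀ t ∈ timeInterval S, f (u z t) = f' (u z t))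
    (hg : ∀ z, ∀ t ∈ timeInterval S, g (u z t) = g' (u z t)) :
    IsBoundedMildSolution f' g' μ φ S u := by
  have hsub : timeInterval S ⊆ timeInterval T := fun t ht => ⟨ht.1, ht.2.trans_le hST⟩
  have hmem : ∀ t ∈ timeInterval S, ∀ s ∈ Ioo 0 t, s ∈ timeInterval S := fun t ht s hs =>
    mem_timeInterval_of_le ht hs.1 hs.2.le
  refine ⟨⟨hS, h.1.continuousOn.mono (prod_mono_right hsub), h.1.initial,
    fun z t ht => h.1.integrable_initial z t (hsub ht), fun z t ht => ?_, fun z t ht => ?_,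
    fun z t ht => ?_⟩, fun τ hτ => h.2 τ (hsub hτ)⟩
  · refine (h.1.integrable_f z t (hsub ht)).congr ?_
    filter_upwards [ae_spaceTime t] with p hp
    rw [hf _ _ (hmem t ht _ hp)]
  · refine (h.1.integrable_g z t (hsub ht)).congr ?_
    filter_upwards [ae_spaceTime t] with p hp
    rw [hg _ _ (hmem t ht _ hp)]
  · rw [h.1.duhamel z t (hsub ht)]
    congr 1
    refine setIntegral_congr_fun measurableSet_Ioo fun s hs => ?_
    simp only [fun w => hf w s (hmem t ht _ hs), fun w => hg w s (hmem t ht _ hs)]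

theorem IsMildSolution.eq_heatEvol_add [SFinite μ] (h : IsMildSolution f g μ φ T u) (z : ℝ × ℝ)
    {t : ℝ} (ht : t ∈ timeInterval T) :
    u z t = heatEvol φ z t +
      (∫ p, heatK z p.2 (t - p.1) * f (u p.2 p.1) ∂(spaceTime (μ.prod volume) t) +
        ∫ p, heatK z p.2 (t - p.1) * g (u p.2 p.1) ∂(spaceTime volume t)) := by
  rw [h.duhamel z t ht, ← integral_heatK_mul_eq φ z ht.1,
    integral_prod _ (h.integrable_f z t ht), integral_prod _ (h.integrable_g z t ht),
    ← integral_add (h.integrable_f z t ht).integral_prod_left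
      (h.integrable_g z t ht).integral_prod_left]

/-- An exponent for which the Duhamel map is a contraction with constant `1/2` in the norm
weighted by `e^{-λ t}`. -/
def ContractionExponent (K : NNReal) (A l : ℝ) : Prop :=
  0 < l ∧ K * (A + 1) * laplaceWeight l ≤ 1 / 2

theorem exists_contractionExponent (K : NNReal) (A : ℝ) : ∃ l, ContractionExponent K A l :=
  exists_laplaceWeight_le _ (by norm_num)

end

section

variable {f g : ℝ → ℝ} {μ : Measure ℝ} [SFinite μ] {A : ℝ} {K : NNReal} {l : ℝ}

/-- Lipschitz dependence of bounded mild solutions on the initial data. With `N` the supremum of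
`e^{-λ s} |u - v|` over `(0, t]`, the Duhamel formula gives `N ≤ ‖φ - ψ‖ + N / 2`. -/
theorem abs_sub_le_of_mild (hμ : HasHeatBound (μ.prod volume) A) (hf : LipschitzWith K f)
    (hg : LipschitzWith K g) (hl : ContractionExponent K A l) {φ ψ : (ℝ × ℝ) →ᵇ ℝ} {T : EReal}
    {u v : ℝ × ℝ → ℝ → ℝ} (hu : IsBoundedMildSolution f g μ φ T u)
    (hv : IsBoundedMildSolution f g μ ψ T v) (z : ℝ × ℝ) {t : ℝ} (ht : t ∈ timeInterval T) :
    |u z t - v z t| ≤ 2 * dist φ ψ * Real.exp (l * t) := by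
  obtain ⟨Mu, hMu⟩ := hu.2 t ht
  obtain ⟨Mv, hMv⟩ := hv.2 t ht
  let X : Set ℝ := {x | ∃ z, ∃ s ∈ Ioc 0 t, x = Real.exp (-(l * s)) * |u z s - v z s|}
  have hX : BddAbove X := by
    refine ⟨Mu + Mv, ?_⟩
    rintro _ ⟨z, s, hs, rfl⟩
    have h1 : Real.exp (-(l * s)) ≤ 1 := by
      rw [Real.exp_le_one_iff]; have := mul_pos hl.1 hs.1; linarith
    calc _ ≤ 1 * |u z s - v z s| := by gcongr
      _ ≤ |u z s| + |v z s| := by rw [one_mul]; exact abs_sub _ _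
      _ ≤ _ := add_le_add (hMu z s hs) (hMv z s hs)
  have hXne : X.Nonempty := ⟨_, 0, t, ⟨ht.1, le_rfl⟩, rfl⟩
  set N := sSup X with hN
  have hle : ∀ z, ∀ s ∈ Ioc 0 t, |u z s - v z s| ≤ N * Real.exp (l * s) := fun z s hs => by
    have h1 : Real.exp (-(l * s)) * |u z s - v z s| ≤ N := le_csSup hX ⟨z, s, hs, rfl⟩
    rwa [Real.exp_neg, inv_mul_le_iff₀ (Real.exp_pos _), mul_comm] at h1
  have hN0 : 0 ≤ N := by
    have := hle 0 t ⟨ht.1, le_rfl⟩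
    exact nonneg_of_mul_nonneg_left ((abs_nonneg _).trans this) (Real.exp_pos _)
  have key : ∀ z, ∀ s ∈ Ioc 0 t, |u z s - v z s| ≤ (dist φ ψ + N / 2) * Real.exp (l * s) :=
      fun z s hs => by
    have hsT : s ∈ timeInterval T := mem_timeInterval_of_le ht hs.1 hs.2
    have hdiff : ∀ {k : ℝ → ℝ}, LipschitzWith K k → ∀ w, ∀ r ∈ Ioo 0 s,
        |k (u w r) - k (v w r)| ≤ K * N * Real.exp (l * r) := fun {k} hk w r hr => by
      have := hk.dist_le_mul (u w r) (v w r)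
      rw [Real.dist_eq, Real.dist_eq] at this
      refine this.trans ?_
      rw [mul_assoc]
      exact mul_le_mul_of_nonneg_left (hle w r ⟨hr.1, hr.2.le.trans hs.2⟩) K.coe_nonneg
    have e1 : |heatEvol φ z s - heatEvol ψ z s| ≤ dist φ ψ := by
      rw [heatEvol_sub (B := max ‖φ‖ ‖ψ‖) z φ.continuous ψ.continuous
        (fun w => (φ.norm_coe_le_norm w).trans (le_max_left _ _))
        (fun w => (ψ.norm_coe_le_norm w).trans (le_max_right _ _)) hs.1]
      exact abs_heatEvol_le (fun w => by
        rw [← Real.dist_eq]; exact BoundedContinuousFunction.dist_coe_le_dist w) z s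
    have e2 := abs_integral_spaceTime_le hμ (h := fun w r => f (u w r) - f (v w r))
      (mul_nonneg K.coe_nonneg hN0) hl.1 (hdiff hf) z
    have e3 := abs_integral_spaceTime_le hasHeatBound_volume
      (h := fun w r => g (u w r) - g (v w r)) (mul_nonneg K.coe_nonneg hN0) hl.1 (hdiff hg) z
    simp_rw [mul_sub] at e2 e3
    rw [integral_sub (hu.1.integrable_f z s hsT) (hv.1.integrable_f z s hsT)] at e2
    rw [integral_sub (hu.1.integrable_g z s hsT) (hv.1.integrable_g z s hsT)] at e3
    rw [hu.1.eq_heatEvol_add z hsT, hv.1.eq_heatEvol_add z hsT]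
    have h1 : 1 ≤ Real.exp (l * s) := Real.one_le_exp (mul_nonneg hl.1.le hs.1.le)
    have h2 : K * (A + 1) * laplaceWeight l * (N * Real.exp (l * s)) ≤
        1 / 2 * (N * Real.exp (l * s)) :=
      mul_le_mul_of_nonneg_right hl.2 (by positivity)
    have h3 : dist φ ψ * 1 ≤ dist φ ψ * Real.exp (l * s) :=
      mul_le_mul_of_nonneg_left h1 dist_nonneg
    rw [add_sub_add_comm, add_sub_add_comm]
    refine (abs_add_le _ _).trans ?_
    refine (add_le_add e1 ((abs_add_le _ _).trans (add_le_add e2 e3))).trans ?_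
    linarith
  have hNle : N ≤ dist φ ψ + N / 2 := by
    refine csSup_le hXne ?_
    rintro _ ⟨z, s, hs, rfl⟩
    rw [Real.exp_neg, inv_mul_le_iff₀ (Real.exp_pos _), mul_comm]
    exact key z s hs
  refine (hle z t ⟨ht.1, le_rfl⟩).trans (mul_le_mul_of_nonneg_right ?_ (Real.exp_pos _).le)
  linarith

theorem abs_duhamel_le {ν : Measure (ℝ × ℝ)} [SFinite ν] (hν : HasHeatBound ν A)
    {h : ℝ × ℝ → ℝ → ℝ} {B : ℝ} (hB : 0 ≤ B) (hl : 0 < l)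
    (hc : Continuous fun p : (ℝ × ℝ) × ℝ => h p.1 p.2)
    (hh : ∀ w, ∀ s, 0 < s → |h w s| ≤ B * Real.exp (l * s)) (z : ℝ × ℝ) (t : ℝ) :
    |duhamel ν h z t| ≤ B * (A * laplaceWeight l) * Real.exp (l * max t 0) := by
  rcases le_or_gt t 0 with ht | ht
  · rw [duhamel_of_nonpos _ _ _ ht, abs_zero]
    exact mul_nonneg (mul_nonneg hB (mul_nonneg hν.1 (laplaceWeight_nonneg hl)))
      (Real.exp_pos _).le
  · have hm : AEStronglyMeasurable (fun p : ℝ × (ℝ × ℝ) => h p.2 p.1) (spaceTime ν t) :=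
      (hc.comp continuous_swap).measurable.aestronglyMeasurable
    rw [duhamel_eq_integral (integrable_spaceTime hν hl hm (fun w s hs => hh w s hs.1) z),
      max_eq_left ht.le]
    refine (abs_integral_spaceTime_le hν hB hl (fun w s hs => hh w s hs.1) z).trans_eq ?_
    ring

theorem integrable_spaceTime_of_bounded {ν : Measure (ℝ × ℝ)} [SFinite ν] (hν : HasHeatBound ν A)
    {h : ℝ × ℝ → ℝ → ℝ} {B : ℝ} (hm : Measurable fun p : ℝ × (ℝ × ℝ) => h p.2 p.1)
    (hB : ∀ w s, |h w s| ≤ B) (z : ℝ × ℝ) (t : ℝ) :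
    Integrable (fun p : ℝ × (ℝ × ℝ) => heatK z p.2 (t - p.1) * h p.2 p.1) (spaceTime ν t) := by
  have hB0 : 0 ≤ B := (abs_nonneg _).trans (hB 0 0)
  refine integrable_spaceTime hν (B := B) one_pos hm.aestronglyMeasurable (fun w s hs => ?_) z
  refine (hB w s).trans (le_mul_of_one_le_right hB0 (Real.one_le_exp ?_))
  rw [one_mul]; exact hs.1.le

theorem duhamel_sub {ν : Measure (ℝ × ℝ)} [SFinite ν] (hν : HasHeatBound ν A)
    {h k : ℝ × ℝ → ℝ → ℝ} {B : ℝ} (hm : Measurable fun p : ℝ × (ℝ × ℝ) => h p.2 p.1)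
    (km : Measurable fun p : ℝ × (ℝ × ℝ) => k p.2 p.1)
    (hB : ∀ w s, |h w s| ≤ B) (kB : ∀ w s, |k w s| ≤ B) (z : ℝ × ℝ) (t : ℝ) :
    duhamel ν h z t - duhamel ν k z t = duhamel ν (fun w s => h w s - k w s) z t := by
  have hi := integrable_spaceTime_of_bounded hν hm hB z t
  have ki := integrable_spaceTime_of_bounded hν km kB z t
  have hk := hi.sub ki
  rw [duhamel_eq_integral hi, duhamel_eq_integral ki, duhamel_eq_integral]
  · simp_rw [mul_sub]
    exact (integral_sub hi ki).symm
  · simp_rw [mul_sub]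
    exact hk

/-- For bounded Lipschitz nonlinearities there is a global mild solution: the Duhamel map, written
for `w = e^{-λ t⁺} u`, is a contraction of the space of bounded continuous functions on
`ℝ² × ℝ`. -/
theorem exists_global_mild (hμ : HasHeatBound (μ.prod volume) A) (hf : LipschitzWith K f)
    (hg : LipschitzWith K g) {B : ℝ} (hB : 0 ≤ B) (hfB : ∀ x, |f x| ≤ B) (hgB : ∀ x, |g x| ≤ B)
    (φ : (ℝ × ℝ) →ᵇ ℝ) : ∃ u, IsBoundedMildSolution f g μ φ ⊤ u := by
  obtain ⟨l, hl⟩ := exists_contractionExponent K A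
  set c := laplaceWeight l with hc
  have hc0 : 0 ≤ c := laplaceWeight_nonneg hl.1
  have hA := hμ.1
  -- the weight is frozen for `t ≤ 0`, where the Duhamel map returns the initial data
  let E : ℝ → ℝ := fun t => Real.exp (l * max t 0)
  have hE0 : ∀ t, 0 < E t := fun t => Real.exp_pos _
  have hE1 : ∀ t, 1 ≤ E t := fun t =>
    Real.one_le_exp (mul_nonneg hl.1.le (le_max_right _ _))
  have hEc : Continuous E := by fun_prop
  have hEpos : ∀ t, 0 < t → E t = Real.exp (l * t) := fun t ht => by
    simp only [E, max_eq_left ht.le]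
  let src : (ℝ → ℝ) → ((ℝ × ℝ) × ℝ →ᵇ ℝ) → ℝ × ℝ → ℝ → ℝ := fun k w z s => k (E s * w (z, s))
  have hsc : ∀ {k : ℝ → ℝ}, Continuous k → ∀ w,
      Continuous fun p : (ℝ × ℝ) × ℝ => src k w p.1 p.2 := fun hk w =>
    hk.comp ((hEc.comp continuous_snd).mul w.continuous)
  have hsm : ∀ {k : ℝ → ℝ}, Continuous k → ∀ w,
      Measurable fun p : ℝ × (ℝ × ℝ) => src k w p.2 p.1 := fun hk w =>
    ((hsc hk w).comp continuous_swap).measurable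
  let U : ((ℝ × ℝ) × ℝ →ᵇ ℝ) → (ℝ × ℝ) × ℝ → ℝ := fun w p =>
    heatEvol φ p.1 p.2 + (duhamel (μ.prod volume) (src f w) p.1 p.2 +
      duhamel volume (src g w) p.1 p.2)
  have hUc : ∀ w, Continuous (U w) := fun w =>
    (continuous_heatEvol φ).add ((continuous_duhamel hμ (hsc hf.continuous w)
      fun z s => hfB _).add (continuous_duhamel hasHeatBound_volume (hsc hg.continuous w)
        fun z s => hgB _))
  have hUb : ∀ w p, ‖(E p.2)⁻¹ * U w p‖ ≤ ‖φ‖ + B * (A + 1) * c := fun w p => by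
    have hexp : ∀ s, 0 < s → B ≤ B * Real.exp (l * s) := fun s hs =>
      le_mul_of_one_le_right hB (Real.one_le_exp (mul_nonneg hl.1.le hs.le))
    have e1 := abs_heatEvol_le (φ := φ) φ.norm_coe_le_norm p.1 p.2
    have e2 := abs_duhamel_le hμ hB hl.1 (hsc hf.continuous w)
      (fun z s hs => (hfB _).trans (hexp s hs)) p.1 p.2
    have e3 := abs_duhamel_le hasHeatBound_volume hB hl.1 (hsc hg.continuous w)
      (fun z s hs => (hgB _).trans (hexp s hs)) p.1 p.2
    rw [norm_mul, norm_inv, Real.norm_of_nonneg (hE0 _).le, inv_mul_le_iff₀ (hE0 _)]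
    have e0 : ‖φ‖ * 1 ≤ ‖φ‖ * E p.2 := mul_le_mul_of_nonneg_left (hE1 _) (norm_nonneg _)
    refine (abs_add_le _ _).trans ((add_le_add e1 ((abs_add_le _ _).trans
      (add_le_add e2 e3))).trans ?_)
    change _ + (_ * E p.2 + _ * E p.2) ≤ _
    rw [← hc]
    linarith
  let Φ : ((ℝ × ℝ) × ℝ →ᵇ ℝ) → ((ℝ × ℝ) × ℝ →ᵇ ℝ) := fun w =>
    BoundedContinuousFunction.ofNormedAddCommGroup (fun p => (E p.2)⁻¹ * U w p)
      (((hEc.comp continuous_snd).inv₀ fun p => (hE0 _).ne').mul (hUc w)) _ (hUb w)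
  have hΦ : ContractingWith (1 / 2) Φ := by
    refine ⟨NNReal.half_lt_self one_ne_zero,
      LipschitzWith.of_dist_le_mul fun w w' => ?_⟩
    rw [BoundedContinuousFunction.dist_le (by positivity)]
    intro p
    have hd : ∀ {k : ℝ → ℝ}, LipschitzWith K k → ∀ z s, 0 < s →
        |src k w z s - src k w' z s| ≤ K * dist w w' * Real.exp (l * s) := fun {k} hk z s hs => by
      have h1 := hk.dist_le_mul (E s * w (z, s)) (E s * w' (z, s))
      rw [Real.dist_eq, Real.dist_eq, ← mul_sub, abs_mul, abs_of_pos (hE0 s)] at h1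
      have h2 : |w (z, s) - w' (z, s)| ≤ dist w w' := by
        rw [← Real.dist_eq]; exact BoundedContinuousFunction.dist_coe_le_dist _
      refine h1.trans ?_
      rw [← hEpos s hs, mul_assoc, mul_comm (dist w w')]
      gcongr
    have hKd : 0 ≤ K * dist w w' := by positivity
    have e2 := abs_duhamel_le hμ hKd hl.1 ((hsc hf.continuous w).sub (hsc hf.continuous w'))
      (hd hf) p.1 p.2
    have e3 := abs_duhamel_le hasHeatBound_volume hKd hl.1
      ((hsc hg.continuous w).sub (hsc hg.continuous w')) (hd hg) p.1 p.2
    rw [← duhamel_sub hμ (hsm hf.continuous w) (hsm hf.continuous w') (fun z s => hfB _)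
      (fun z s => hfB _)] at e2
    rw [← duhamel_sub hasHeatBound_volume (hsm hg.continuous w) (hsm hg.continuous w')
      (fun z s => hgB _) (fun z s => hgB _)] at e3
    change |(E p.2)⁻¹ * U w p - (E p.2)⁻¹ * U w' p| ≤ _
    rw [← mul_sub, abs_mul, abs_inv, abs_of_pos (hE0 _), inv_mul_le_iff₀ (hE0 _)]
    have hUsub : U w p - U w' p =
        (duhamel (μ.prod volume) (src f w) p.1 p.2 -
          duhamel (μ.prod volume) (src f w') p.1 p.2) +
        (duhamel volume (src g w) p.1 p.2 - duhamel volume (src g w') p.1 p.2) := by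
      simp only [U]; ring
    rw [hUsub]
    refine (abs_add_le _ _).trans ((add_le_add e2 e3).trans ?_)
    change _ * E p.2 + _ * E p.2 ≤ _
    have h2 : K * (A + 1) * c * (dist w w' * E p.2) ≤ 1 / 2 * (dist w w' * E p.2) :=
      mul_le_mul_of_nonneg_right hl.2 (mul_nonneg dist_nonneg (hE0 _).le)
    rw [← hc]
    push_cast
    linarith
  set w := hΦ.fixedPoint Φ with hw
  have hfix : ∀ p, E p.2 * w p = U w p := fun p => by
    have h1 : Φ w = w := hΦ.fixedPoint_isFixedPt
    have h2 : w p = (E p.2)⁻¹ * U w p := by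
      conv_lhs => rw [← h1]
      rfl
    rw [h2, mul_inv_cancel_left₀ (hE0 _).ne']
  -- the equation `E w = U w` is the Duhamel formula for `u = E w`
  refine ⟨fun z t => E t * w (z, t), ⟨by simp, ?_, fun z => ?_, fun z t ht => ?_,
    fun z t ht => ?_, fun z t ht => ?_, fun z t ht => ?_⟩, fun τ hτ => ?_⟩
  · exact ((hEc.comp continuous_snd).mul w.continuous).continuousOn
  · have h0 : E 0 * w (z, 0) = φ z := by
      have := hfix (z, 0)
      simp only at this
      rw [this]
      simp only [U]
      rw [heatEvol_of_nonpos _ _ le_rfl, duhamel_of_nonpos _ _ _ le_rfl,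
        duhamel_of_nonpos _ _ _ le_rfl, add_zero, add_zero]
    rw [← h0]
    have : Continuous fun t => E t * w (z, t) := by fun_prop
    exact (this.tendsto 0).mono_left nhdsWithin_le_nhds
  · exact integrable_heatK_mul φ.continuous φ.norm_coe_le_norm z ht.1
  · exact integrable_spaceTime_of_bounded hμ (hsm hf.continuous w) (fun z s => hfB _) z t
  · exact integrable_spaceTime_of_bounded hasHeatBound_volume (hsm hg.continuous w)
      (fun z s => hgB _) z t
  · have i1 := integrable_spaceTime_of_bounded hμ (hsm hf.continuous w) (fun z s => hfB _) z t
    have i2 := integrable_spaceTime_of_bounded hasHeatBound_volume (hsm hg.continuous w)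
      (fun z s => hgB _) z t
    refine (hfix (z, t)).trans ?_
    rw [integral_add i1.integral_prod_left i2.integral_prod_left]
    simp only [U]
    rw [← integral_heatK_mul_eq _ _ ht.1]
    rfl
  · refine ⟨Real.exp (l * τ) * ‖w‖, fun z t ht => ?_⟩
    rw [abs_mul, abs_of_pos (hE0 _), hEpos t ht.1]
    have := w.norm_coe_le_norm (z, t)
    rw [Real.norm_eq_abs] at this
    gcongr
    · exact hl.1.le
    · exact ht.2

end

/-! ### The adjoint heat operator and the fundamental solution -/

/-- The partial derivative of `η` on space-time `ℝ² × ℝ` in the direction `v`. -/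
noncomputable def partialD (v : (ℝ × ℝ) × ℝ) (η : (ℝ × ℝ) × ℝ → ℝ) (p : (ℝ × ℝ) × ℝ) : ℝ :=
  fderiv ℝ η p v

/-- The adjoint heat operator `∂ₜ + ∂ₓₓ + ∂_yy`. -/
noncomputable def adjointHeat (η : (ℝ × ℝ) × ℝ → ℝ) (p : (ℝ × ℝ) × ℝ) : ℝ :=
  partialD (0, 1) η p + (partialD ((1, 0), 0) (partialD ((1, 0), 0) η) p +
    partialD ((0, 1), 0) (partialD ((0, 1), 0) η) p)

section TestFunction

variable {η : (ℝ × ℝ) × ℝ → ℝ}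

theorem contDiff_partialD (hη : ContDiff ℝ ∞ η) (v : (ℝ × ℝ) × ℝ) :
    ContDiff ℝ ∞ (partialD v η) :=
  (hη.fderiv_right (m := ∞) (by simp)).clm_apply contDiff_const

theorem tsupport_partialD_subset (v : (ℝ × ℝ) × ℝ) (η : (ℝ × ℝ) × ℝ → ℝ) :
    tsupport (partialD v η) ⊆ tsupport η :=
  tsupport_fderiv_apply_subset ℝ v

theorem partialD_eq_zero (v : (ℝ × ℝ) × ℝ) {p : (ℝ × ℝ) × ℝ} (hp : p ∉ tsupport η) :
    partialD v η p = 0 :=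
  image_eq_zero_of_notMem_tsupport fun h => hp (tsupport_partialD_subset v η h)

theorem partialD_partialD_eq_zero (v v' : (ℝ × ℝ) × ℝ) {p : (ℝ × ℝ) × ℝ} (hp : p ∉ tsupport η) :
    partialD v (partialD v' η) p = 0 :=
  partialD_eq_zero v fun h => hp (tsupport_partialD_subset v' η h)

theorem adjointHeat_eq_zero {p : (ℝ × ℝ) × ℝ} (hp : p ∉ tsupport η) : adjointHeat η p = 0 := by
  simp [adjointHeat, partialD_eq_zero _ hp, partialD_partialD_eq_zero _ _ hp]

theorem continuous_adjointHeat (hη : ContDiff ℝ ∞ η) : Continuous (adjointHeat η) :=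
  (contDiff_partialD hη _).continuous.add
    ((contDiff_partialD (contDiff_partialD hη _) _).continuous.add
      (contDiff_partialD (contDiff_partialD hη _) _).continuous)

theorem hasCompactSupport_of_eq_zero (hc : HasCompactSupport η) {k : (ℝ × ℝ) × ℝ → ℝ}
    (hk : ∀ p, p ∉ tsupport η → k p = 0) : HasCompactSupport k :=
  HasCompactSupport.intro hc hk

theorem hasDerivAt_time (hη : ContDiff ℝ ∞ η) (z : ℝ × ℝ) (t : ℝ) :
    HasDerivAt (fun s => η (z, s)) (partialD (0, 1) η (z, t)) t := by
  have h1 : HasFDerivAt η (fderiv ℝ η (z, t)) (z, t) :=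
    (hη.differentiable (by simp) _).hasFDerivAt
  exact h1.comp_hasDerivAt t ((hasDerivAt_const t z).prodMk (hasDerivAt_id t))

theorem hasDerivAt_x (hη : ContDiff ℝ ∞ η) (x y t : ℝ) :
    HasDerivAt (fun x => η ((x, y), t)) (partialD ((1, 0), 0) η ((x, y), t)) x := by
  have h1 : HasFDerivAt η (fderiv ℝ η ((x, y), t)) ((x, y), t) :=
    (hη.differentiable (by simp) _).hasFDerivAt
  exact h1.comp_hasDerivAt x (((hasDerivAt_id x).prodMk (hasDerivAt_const x y)).prodMk
    (hasDerivAt_const x t))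

theorem hasDerivAt_y (hη : ContDiff ℝ ∞ η) (x y t : ℝ) :
    HasDerivAt (fun y => η ((x, y), t)) (partialD ((0, 1), 0) η ((x, y), t)) y := by
  have h1 : HasFDerivAt η (fderiv ℝ η ((x, y), t)) ((x, y), t) :=
    (hη.differentiable (by simp) _).hasFDerivAt
  exact h1.comp_hasDerivAt y (((hasDerivAt_const y x).prodMk (hasDerivAt_id y)).prodMk
    (hasDerivAt_const y t))

theorem iteratedDeriv_two_x (hη : ContDiff ℝ ∞ η) (z : ℝ × ℝ) (t : ℝ) :
    iteratedDeriv 2 (fun x => η ((x, z.2), t)) z.1 =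
      partialD ((1, 0), 0) (partialD ((1, 0), 0) η) (z, t) := by
  rw [iteratedDeriv_succ, iteratedDeriv_one]
  have : deriv (fun x => η ((x, z.2), t)) = fun x => partialD ((1, 0), 0) η ((x, z.2), t) :=
    funext fun x => (hasDerivAt_x hη x z.2 t).deriv
  rw [this, (hasDerivAt_x (contDiff_partialD hη _) z.1 z.2 t).deriv]

theorem iteratedDeriv_two_y (hη : ContDiff ℝ ∞ η) (z : ℝ × ℝ) (t : ℝ) :
    iteratedDeriv 2 (fun y => η ((z.1, y), t)) z.2 =
      partialD ((0, 1), 0) (partialD ((0, 1), 0) η) (z, t) := by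
  rw [iteratedDeriv_succ, iteratedDeriv_one]
  have : deriv (fun y => η ((z.1, y), t)) = fun y => partialD ((0, 1), 0) η ((z.1, y), t) :=
    funext fun y => (hasDerivAt_y hη z.1 y t).deriv
  rw [this, (hasDerivAt_y (contDiff_partialD hη _) z.1 z.2 t).deriv]

theorem hasLineDerivAt_slice (hη : ContDiff ℝ ∞ η) (v z : ℝ × ℝ) (t : ℝ) :
    HasLineDerivAt ℝ (fun z => η (z, t)) (partialD (v, 0) η (z, t)) z v := by
  have h1 : HasFDerivAt η (fderiv ℝ η (z, t)) (z, t) :=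
    (hη.differentiable (by simp) _).hasFDerivAt
  have h2 := h1.hasLineDerivAt (v, 0)
  unfold HasLineDerivAt at h2 ⊢
  simpa [partialD] using h2

theorem slice_hasCompactSupport (hc : HasCompactSupport η) (t : ℝ) :
    HasCompactSupport fun z => η (z, t) :=
  HasCompactSupport.intro (hc.image continuous_fst) fun z hz =>
    image_eq_zero_of_notMem_tsupport fun h => hz ⟨(z, t), h, rfl⟩

end TestFunction

/-- Integrating by parts twice in the direction `v`. -/
theorem integral_mul_lineDeriv_twice {f f' f'' g g' g'' : ℝ × ℝ → ℝ} {v : ℝ × ℝ}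
    (hf : Continuous f) (hf' : Continuous f') (hf'' : Continuous f'')
    (hg : Continuous g) (hg' : Continuous g') (hg'' : Continuous g'')
    (cg : HasCompactSupport g) (cg' : HasCompactSupport g') (cg'' : HasCompactSupport g'')
    (df : ∀ x, HasLineDerivAt ℝ f (f' x) x v) (df' : ∀ x, HasLineDerivAt ℝ f' (f'' x) x v)
    (dg : ∀ x, HasLineDerivAt ℝ g (g' x) x v) (dg' : ∀ x, HasLineDerivAt ℝ g' (g'' x) x v) :
    ∫ x, f x * g'' x = ∫ x, f'' x * g x := by
  have I : ∀ {a b : ℝ × ℝ → ℝ}, Continuous a → Continuous b → HasCompactSupport b →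
      Integrable fun x => a x * b x := fun ha hb cb =>
    (ha.mul hb).integrable_of_hasCompactSupport cb.mul_left
  have h1 := integral_bilinear_hasLineDerivAt_right_eq_neg_left_of_integrable (μ := volume)
    (B := ContinuousLinearMap.mul ℝ ℝ) (I hf' hg' cg') (I hf hg'' cg'') (I hf hg' cg')
    (fun x _ => df x) (fun x _ => dg' x)
  have h2 := integral_bilinear_hasLineDerivAt_right_eq_neg_left_of_integrable (μ := volume)
    (B := ContinuousLinearMap.mul ℝ ℝ) (I hf'' hg cg) (I hf' hg' cg') (I hf' hg cg)
    (fun x _ => df' x) (fun x _ => dg x)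
  simp only [ContinuousLinearMap.mul_apply'] at h1 h2
  rw [h1, h2, neg_neg]

theorem continuous_heatK (w : ℝ × ℝ) (r : ℝ) : Continuous fun z => heatK w z r :=
  (continuous_heatKernel r).comp (by fun_prop :
    Continuous fun z : ℝ × ℝ => (w.1 - z.1, w.2 - z.2))

theorem heatK_comm (z w : ℝ × ℝ) (r : ℝ) : heatK z w r = heatK w z r := by
  unfold heatK heatKernel
  rw [← neg_sub z.1, ← neg_sub z.2, neg_sq, neg_sq]

theorem hasDerivAt_heatKernel_x (x y r : ℝ) :
    HasDerivAt (fun x => heatKernel x y r) (heatKernel x y r * (-x / (2 * r))) x := by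
  unfold heatKernel
  have h1 : HasDerivAt (fun x : ℝ => -(x ^ 2 + y ^ 2) / (4 * r)) (-x / (2 * r)) x := by
    have := (((hasDerivAt_pow 2 x).add_const (y ^ 2)).neg).div_const (4 * r)
    refine this.congr_deriv ?_
    rcases eq_or_ne r 0 with rfl | hr
    · simp
    · field_simp; norm_num; ring
  exact (h1.exp.const_mul _).congr_deriv (by ring)

theorem hasDerivAt_heatKernel_y (x y r : ℝ) :
    HasDerivAt (fun y => heatKernel x y r) (heatKernel x y r * (-y / (2 * r))) y := by
  have e : ∀ x y, heatKernel x y r = heatKernel y x r := fun x y => by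
    unfold heatKernel; rw [add_comm]
  simp_rw [e x]
  exact hasDerivAt_heatKernel_x y x r

theorem hasDerivAt_heatKernel_t (x y : ℝ) {r : ℝ} (hr : 0 < r) :
    HasDerivAt (fun r => heatKernel x y r)
      (heatKernel x y r * ((x ^ 2 + y ^ 2) / (4 * r ^ 2) - 1 / r)) r := by
  unfold heatKernel
  have h1 : HasDerivAt (fun r : ℝ => -(x ^ 2 + y ^ 2) / (4 * r))
      ((x ^ 2 + y ^ 2) / (4 * r ^ 2)) r := by
    have := (hasDerivAt_const r (-(x ^ 2 + y ^ 2))).div ((hasDerivAt_id r).const_mul 4)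
      (by simp [hr.ne'])
    refine this.congr_deriv ?_
    simp only [id]
    field_simp; ring
  have h2 : HasDerivAt (fun r : ℝ => 1 / (4 * Real.pi * r))
      (1 / (4 * Real.pi * r) * -(1 / r)) r := by
    have := (hasDerivAt_const r (1 : ℝ)).div ((hasDerivAt_id r).const_mul (4 * Real.pi))
      (by simp [hr.ne', Real.pi_ne_zero])
    refine this.congr_deriv ?_
    simp only [id]
    field_simp; ring
  exact (h2.mul h1.exp).congr_deriv (by ring)

theorem hasDerivAt_sub_add_mul (a b c : ℝ) :
    HasDerivAt (fun s : ℝ => a - (b + s * c)) (-c) 0 := by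
  simpa using (((hasDerivAt_id (0 : ℝ)).mul_const c).const_add b).const_sub a

theorem hasLineDerivAt_heatK_x (w z : ℝ × ℝ) (r : ℝ) :
    HasLineDerivAt ℝ (fun z => heatK w z r) (heatK w z r * ((w.1 - z.1) / (2 * r))) z (1, 0) := by
  have h1 := HasDerivAt.comp_of_eq (0 : ℝ) (hasDerivAt_heatKernel_x (w.1 - z.1) (w.2 - z.2) r)
    (hasDerivAt_sub_add_mul w.1 z.1 1) (by simp)
  refine (h1.congr_of_eventuallyEq (Eventually.of_forall fun s => ?_)).congr_deriv ?_
  · simp [heatK]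
  · simp only [heatK]; ring

theorem hasLineDerivAt_heatK_y (w z : ℝ × ℝ) (r : ℝ) :
    HasLineDerivAt ℝ (fun z => heatK w z r) (heatK w z r * ((w.2 - z.2) / (2 * r))) z (0, 1) := by
  have h1 := HasDerivAt.comp_of_eq (0 : ℝ) (hasDerivAt_heatKernel_y (w.1 - z.1) (w.2 - z.2) r)
    (hasDerivAt_sub_add_mul w.2 z.2 1) (by simp)
  refine (h1.congr_of_eventuallyEq (Eventually.of_forall fun s => ?_)).congr_deriv ?_
  · simp [heatK]
  · simp only [heatK]; ring

theorem hasLineDerivAt_heatK_xx (w z : ℝ × ℝ) {r : ℝ} (hr : r ≠ 0) :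
    HasLineDerivAt ℝ (fun z => heatK w z r * ((w.1 - z.1) / (2 * r)))
      (heatK w z r * ((w.1 - z.1) ^ 2 / (4 * r ^ 2) - 1 / (2 * r))) z (1, 0) := by
  have h := HasDerivAt.mul (hasLineDerivAt_heatK_x w z r)
    ((hasDerivAt_sub_add_mul w.1 z.1 1).div_const (2 * r))
  refine (h.congr_of_eventuallyEq (Eventually.of_forall fun s => ?_)).congr_deriv ?_
  · simp
  · simp only [zero_smul, add_zero, zero_mul]; field_simp; ring

theorem hasLineDerivAt_heatK_yy (w z : ℝ × ℝ) {r : ℝ} (hr : r ≠ 0) :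
    HasLineDerivAt ℝ (fun z => heatK w z r * ((w.2 - z.2) / (2 * r)))
      (heatK w z r * ((w.2 - z.2) ^ 2 / (4 * r ^ 2) - 1 / (2 * r))) z (0, 1) := by
  have h := HasDerivAt.mul (hasLineDerivAt_heatK_y w z r)
    ((hasDerivAt_sub_add_mul w.2 z.2 1).div_const (2 * r))
  refine (h.congr_of_eventuallyEq (Eventually.of_forall fun s => ?_)).congr_deriv ?_
  · simp
  · simp only [zero_smul, add_zero, zero_mul]; field_simp; ring

/-- The heat equation for the kernel, tested against a slice of `η`: the time derivative of the
kernel is transferred to the spatial Laplacian of `η`. -/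
theorem integral_heatK_time_deriv {η : (ℝ × ℝ) × ℝ → ℝ} (hη : ContDiff ℝ ∞ η)
    (hc : HasCompactSupport η) (w : ℝ × ℝ) (t : ℝ) {r : ℝ} (hr : 0 < r) :
    ∫ z, heatK w z r * (((w.1 - z.1) ^ 2 + (w.2 - z.2) ^ 2) / (4 * r ^ 2) - 1 / r) * η (z, t) =
      ∫ z, heatK w z r * (partialD ((1, 0), 0) (partialD ((1, 0), 0) η) (z, t) +
        partialD ((0, 1), 0) (partialD ((0, 1), 0) η) (z, t)) := by
  have hk := continuous_heatK w r
  have cont : ∀ {k : (ℝ × ℝ) × ℝ → ℝ}, ContDiff ℝ ∞ k → Continuous fun z => k (z, t) :=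
    fun hk => hk.continuous.comp (by fun_prop)
  have hD := fun v => contDiff_partialD hη v
  have hDD := fun v v' => contDiff_partialD (hD v) v'
  have cD := fun v => hasCompactSupport_of_eq_zero hc fun p hp => partialD_eq_zero v hp
  have cDD := fun v v' => hasCompactSupport_of_eq_zero hc fun p hp =>
    partialD_partialD_eq_zero v v' hp
  have I : ∀ {a : ℝ × ℝ → ℝ} {b : (ℝ × ℝ) × ℝ → ℝ}, Continuous a → ContDiff ℝ ∞ b →
      HasCompactSupport b → Integrable fun x => a x * b (x, t) := fun ha hb cb =>
    (ha.mul (cont hb)).integrable_of_hasCompactSupport (slice_hasCompactSupport cb t).mul_left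
  have ex : ∫ z, heatK w z r * partialD ((1, 0), 0) (partialD ((1, 0), 0) η) (z, t) =
      ∫ z, heatK w z r * ((w.1 - z.1) ^ 2 / (4 * r ^ 2) - 1 / (2 * r)) * η (z, t) := by
    refine integral_mul_lineDeriv_twice (v := (1, 0))
      (f' := fun z => heatK w z r * ((w.1 - z.1) / (2 * r))) (g' := fun z =>
        partialD ((1, 0), 0) η (z, t)) hk (hk.mul (by fun_prop)) (hk.mul (by fun_prop)) (cont hη)
      (cont (hD _)) (cont (hDD _ _)) (slice_hasCompactSupport hc t)
      (slice_hasCompactSupport (cD _) t) (slice_hasCompactSupport (cDD _ _) t)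
      (fun z => hasLineDerivAt_heatK_x w z r) (fun z => hasLineDerivAt_heatK_xx w z hr.ne')
      (fun z => hasLineDerivAt_slice hη _ z t) (fun z => hasLineDerivAt_slice (hD _) _ z t)
  have ey : ∫ z, heatK w z r * partialD ((0, 1), 0) (partialD ((0, 1), 0) η) (z, t) =
      ∫ z, heatK w z r * ((w.2 - z.2) ^ 2 / (4 * r ^ 2) - 1 / (2 * r)) * η (z, t) := by
    refine integral_mul_lineDeriv_twice (v := (0, 1))
      (f' := fun z => heatK w z r * ((w.2 - z.2) / (2 * r))) (g' := fun z =>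
        partialD ((0, 1), 0) η (z, t)) hk (hk.mul (by fun_prop)) (hk.mul (by fun_prop)) (cont hη)
      (cont (hD _)) (cont (hDD _ _)) (slice_hasCompactSupport hc t)
      (slice_hasCompactSupport (cD _) t) (slice_hasCompactSupport (cDD _ _) t)
      (fun z => hasLineDerivAt_heatK_y w z r) (fun z => hasLineDerivAt_heatK_yy w z hr.ne')
      (fun z => hasLineDerivAt_slice hη _ z t) (fun z => hasLineDerivAt_slice (hD _) _ z t)
  simp_rw [mul_add]
  rw [integral_add (I hk (hDD _ _) (cDD _ _)) (I hk (hDD _ _) (cDD _ _)), ex, ey,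
    ← integral_add (I (a := fun z => heatK w z r * ((w.1 - z.1) ^ 2 / (4 * r ^ 2) - 1 / (2 * r)))
        (hk.mul (by fun_prop)) hη hc)
      (I (a := fun z => heatK w z r * ((w.2 - z.2) ^ 2 / (4 * r ^ 2) - 1 / (2 * r)))
        (hk.mul (by fun_prop)) hη hc)]
  congr 1
  ext z
  field_simp
  ring

theorem hasDerivAt_integral_heatK {η : (ℝ × ℝ) × ℝ → ℝ} (hη : ContDiff ℝ ∞ η)
    (hc : HasCompactSupport η) (w : ℝ × ℝ) (s : ℝ) {r : ℝ} (hr : 0 < r) :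
    HasDerivAt (fun r => ∫ z, heatK w z r * η (z, s + r))
      (∫ z, heatK w z r * adjointHeat η (z, s + r)) r := by
  have hk := continuous_heatK w r
  set κ : ℝ → ℝ × ℝ → ℝ := fun r z =>
    heatK w z r * (((w.1 - z.1) ^ 2 + (w.2 - z.2) ^ 2) / (4 * r ^ 2) - 1 / r) with hκ
  set F' : ℝ → ℝ × ℝ → ℝ := fun r z =>
    κ r z * η (z, s + r) + heatK w z r * partialD (0, 1) η (z, s + r) with hF'
  have hD := contDiff_partialD hη (0, 1)
  have cD := hasCompactSupport_of_eq_zero hc fun p hp => partialD_eq_zero (0, 1) hp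
  let S : Set (ℝ × ℝ) := Prod.fst '' tsupport η
  have hS : IsCompact S := hc.image continuous_fst
  have hzero : ∀ z, z ∉ S → ∀ t, (z, t) ∉ tsupport η := fun z hz t h => hz ⟨_, h, rfl⟩
  -- the differentiated integrand is bounded for times near `r`, away from the singularity at `0`
  have hJ : IsCompact (Icc (r / 2) (2 * r) ×ˢ S) := isCompact_Icc.prod hS
  have hF'c : ContinuousOn (fun p : ℝ × (ℝ × ℝ) => F' p.1 p.2) (Icc (r / 2) (2 * r) ×ˢ S) := by
    have hpos : ∀ p ∈ Icc (r / 2) (2 * r) ×ˢ S, p.1 ≠ 0 := fun p hp => by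
      have := hp.1.1; have : 0 < p.1 := by linarith
      exact this.ne'
    have c1 : ContinuousOn (fun p : ℝ × (ℝ × ℝ) => heatK w p.2 p.1)
        (Icc (r / 2) (2 * r) ×ˢ S) := by
      unfold heatK heatKernel
      refine ContinuousOn.mul (ContinuousOn.div (by fun_prop) (by fun_prop) fun p hp => ?_)
        (Real.continuous_exp.comp_continuousOn (ContinuousOn.div (by fun_prop) (by fun_prop)
          fun p hp => ?_))
      · have := hpos p hp; have := Real.pi_ne_zero; positivity
      · have := hpos p hp; positivity
    refine ContinuousOn.add (ContinuousOn.mul (c1.mul (ContinuousOn.sub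
      (ContinuousOn.div (by fun_prop) (by fun_prop) fun p hp => ?_)
      (ContinuousOn.div (by fun_prop) (by fun_prop) fun p hp => hpos p hp))) ?_) (c1.mul ?_)
    · have := hpos p hp; positivity
    · exact (hη.continuous.comp (by fun_prop :
        Continuous fun p : ℝ × (ℝ × ℝ) => (p.2, s + p.1))).continuousOn
    · exact (hD.continuous.comp (by fun_prop :
        Continuous fun p : ℝ × (ℝ × ℝ) => (p.2, s + p.1))).continuousOn
  obtain ⟨C, hC⟩ := hJ.exists_bound_of_continuousOn hF'c
  have slice : ∀ {k : (ℝ × ℝ) × ℝ → ℝ}, ContDiff ℝ ∞ k → ∀ t, Continuous fun z => k (z, t) :=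
    fun hk t => hk.continuous.comp (by fun_prop)
  have hcont : ∀ r', Continuous (F' r') := fun r' =>
    (((continuous_heatK w r').mul (by fun_prop)).mul (slice hη _)).add
      ((continuous_heatK w r').mul (slice hD _))
  have hnhds : Icc (r / 2) (2 * r) ∈ 𝓝 r := Icc_mem_nhds (by linarith) (by linarith)
  have main := (hasDerivAt_integral_of_dominated_loc_of_deriv_le (μ := volume)
    (F := fun r z => heatK w z r * η (z, s + r)) (F' := F') (x₀ := r)
    (bound := S.indicator fun _ => C) hnhds
    (Eventually.of_forall fun r' =>
      ((continuous_heatK w r').mul (slice hη _)).aestronglyMeasurable)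
    ((hk.mul (slice hη _)).integrable_of_hasCompactSupport (slice_hasCompactSupport hc _).mul_left)
    (hcont r).aestronglyMeasurable
    (ae_of_all _ fun z r' hr' => ?_)
    ((integrable_indicator_iff hS.measurableSet).2
      (integrableOn_const hS.measure_lt_top.ne))
    (ae_of_all _ fun z r' hr' => ?_)).2
  · refine main.congr_deriv ?_
    have i1 : Integrable fun z => κ r z * η (z, s + r) :=
      ((hk.mul (by fun_prop)).mul (slice hη _)).integrable_of_hasCompactSupport
        (slice_hasCompactSupport hc _).mul_left
    have i2 : Integrable fun z => heatK w z r * partialD (0, 1) η (z, s + r) :=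
      (hk.mul (slice hD _)).integrable_of_hasCompactSupport
        (slice_hasCompactSupport cD _).mul_left
    have i3 : Integrable fun z => heatK w z r *
        (partialD ((1, 0), 0) (partialD ((1, 0), 0) η) (z, s + r) +
          partialD ((0, 1), 0) (partialD ((0, 1), 0) η) (z, s + r)) := by
      refine (hk.mul ((slice (contDiff_partialD (contDiff_partialD hη _) _) _).add
        (slice (contDiff_partialD (contDiff_partialD hη _) _) _))).integrable_of_hasCompactSupport
        (HasCompactSupport.mul_left (HasCompactSupport.add ?_ ?_))
      · exact slice_hasCompactSupport (hasCompactSupport_of_eq_zero hc fun p hp =>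
          partialD_partialD_eq_zero _ _ hp) _
      · exact slice_hasCompactSupport (hasCompactSupport_of_eq_zero hc fun p hp =>
          partialD_partialD_eq_zero _ _ hp) _
    simp only [hF', adjointHeat]
    rw [integral_add i1 i2, integral_heatK_time_deriv hη hc w (s + r) hr, add_comm]
    simp_rw [mul_add (heatK w _ r) (partialD (0, 1) η _)]
    rw [integral_add i2 i3]
  · by_cases hz : z ∈ S
    · rw [indicator_of_mem hz]
      exact hC (r', z) ⟨hr', hz⟩
    · rw [indicator_of_notMem hz]
      have h0 : η (z, s + r') = 0 := image_eq_zero_of_notMem_tsupport (hzero z hz _)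
      simp [hF', h0, partialD_eq_zero (0, 1) (hzero z hz (s + r'))]
  · have hr0 : 0 < r' := by linarith [hr'.1]
    have h1 := (hasDerivAt_time hη z (s + r')).comp_const_add s r'
    exact (hasDerivAt_heatKernel_t (w.1 - z.1) (w.2 - z.2) hr0).mul h1

/-- The heat kernel is the fundamental solution: pairing the kernel started at `(w, s)` with
`(∂ₜ + Δ) η` gives `-η(w, s)`. This is the fundamental theorem of calculus for
`r ↦ ∫ G(w - z, r) η(z, s + r) dz`, which equals `η(w, s)` at `r = 0` and vanishes for large `r`. -/
theorem integral_heatEvol_adjointHeat {η : (ℝ × ℝ) × ℝ → ℝ} (hη : ContDiff ℝ ∞ η)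
    (hc : HasCompactSupport η) (w : ℝ × ℝ) (s : ℝ) :
    ∫ r in Ioi (0 : ℝ), heatEvol (fun z => adjointHeat η (z, s + r)) w r = -η (w, s) := by
  obtain ⟨R, hR⟩ := (hc.image continuous_snd).bddAbove
  obtain ⟨R', hR'⟩ := (hc.image continuous_snd).bddBelow
  have hzero : ∀ z t, t ∉ Icc R' R → (z, t) ∉ tsupport η := fun z t ht h =>
    ht ⟨hR' ⟨_, h, rfl⟩, hR ⟨_, h, rfl⟩⟩
  have hac : HasCompactSupport (adjointHeat η) :=
    hasCompactSupport_of_eq_zero hc fun p hp => adjointHeat_eq_zero hp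
  obtain ⟨C, hC⟩ := hc.exists_bound_of_continuous hη.continuous
  obtain ⟨C', hC'⟩ := hac.exists_bound_of_continuous (continuous_adjointHeat hη)
  have ca : Continuous fun r => heatEvol (fun z => η (z, s + r)) w r :=
    continuous_heatEvol_param (Φ := fun r z => η (z, s + r)) (hη.continuous.comp (by fun_prop))
      (fun _ _ => hC _) continuous_const continuous_id
  have cb : Continuous fun r => heatEvol (fun z => adjointHeat η (z, s + r)) w r :=
    continuous_heatEvol_param (Φ := fun r z => adjointHeat η (z, s + r))
      ((continuous_adjointHeat hη).comp (by fun_prop)) (fun _ _ => hC' _) continuous_const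
      continuous_id
  have hb0 : ∀ r, r ∉ Icc (R' - s) (R - s) →
      heatEvol (fun z => adjointHeat η (z, s + r)) w r = 0 := fun r hr => by
    have : ∀ z, adjointHeat η (z, s + r) = 0 := fun z => adjointHeat_eq_zero (hzero z _ fun h =>
      hr ⟨by linarith [h.1], by linarith [h.2]⟩)
    simp [heatEvol, this]
  have key := integral_Ioi_of_hasDerivAt_of_tendsto (a := (0 : ℝ)) (m := 0)
    (f := fun r => heatEvol (fun z => η (z, s + r)) w r)
    (f' := fun r => heatEvol (fun z => adjointHeat η (z, s + r)) w r)
    ca.continuousWithinAt (fun r hr => ?_)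
    (cb.integrable_of_hasCompactSupport
      (HasCompactSupport.intro isCompact_Icc hb0)).integrableOn ?_
  · rw [key]
    simp only [add_zero]
    rw [heatEvol_of_nonpos _ _ le_rfl, zero_sub]
  · have h1 := hasDerivAt_integral_heatK hη hc w s hr
    rw [integral_heatK_mul_eq (fun z => adjointHeat η (z, s + r)) w hr] at h1
    refine h1.congr_of_eventuallyEq ?_
    filter_upwards [Ioi_mem_nhds hr] with r' hr'
    exact (integral_heatK_mul_eq _ w hr').symm
  · refine tendsto_const_nhds.congr' ?_
    filter_upwards [eventually_gt_atTop (R - s)] with r hr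
    have : ∀ z, η (z, s + r) = 0 := fun z => image_eq_zero_of_notMem_tsupport
      (hzero z _ fun h => by linarith [h.2])
    simp [heatEvol, this]

/-! ### Potentials of singular sources and weak solutions -/

/-- The fundamental solution of the heat equation, `G(z - w, t - s)` for `s < t` and `0`
otherwise, as a function of `(t, z)` and `(s, w)`. -/
noncomputable def fundSol (q p : ℝ × (ℝ × ℝ)) : ℝ :=
  {x : ℝ | 0 < x}.indicator (fun x => heatK q.2 p.2 x) (q.1 - p.1)

theorem fundSol_of_lt {q p : ℝ × (ℝ × ℝ)} (h : p.1 < q.1) :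
    fundSol q p = heatK q.2 p.2 (q.1 - p.1) :=
  indicator_of_mem (s := {x : ℝ | 0 < x}) (sub_pos.2 h) _

theorem fundSol_of_le {q p : ℝ × (ℝ × ℝ)} (h : q.1 ≤ p.1) : fundSol q p = 0 :=
  indicator_of_notMem (s := {x : ℝ | 0 < x}) (not_lt.2 (sub_nonpos.2 h)) _

theorem measurable_fundSol :
    Measurable fun x : (ℝ × (ℝ × ℝ)) × (ℝ × (ℝ × ℝ)) => fundSol x.1 x.2 := by
  have hs : MeasurableSet
      {x : (ℝ × (ℝ × ℝ)) × (ℝ × (ℝ × ℝ)) | 0 < x.1.1 - x.2.1} :=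
    measurableSet_lt (by fun_prop) (by fun_prop)
  have hm : Measurable fun x : (ℝ × (ℝ × ℝ)) × (ℝ × (ℝ × ℝ)) =>
      heatK x.1.2 x.2.2 (x.1.1 - x.2.1) := by fun_prop
  exact hm.indicator hs

theorem integral_add_add {X : Type*} [MeasurableSpace X] {ρ : Measure X} {a b c : X → ℝ}
    (ha : Integrable a ρ) (hb : Integrable b ρ) (hc : Integrable c ρ) :
    ∫ x, (a x + (b x + c x)) ∂ρ = ∫ x, a x ∂ρ + (∫ x, b x ∂ρ + ∫ x, c x ∂ρ) := by
  have hbc : Integrable (fun x => b x + c x) ρ := hb.add hc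
  rw [integral_add ha hbc, integral_add hb hc]

section Duality

variable {η : (ℝ × ℝ) × ℝ → ℝ}

theorem integral_adjointHeat_fundSol (hη : ContDiff ℝ ∞ η) (hc : HasCompactSupport η)
    (p : ℝ × (ℝ × ℝ)) :
    ∫ t, ∫ z, adjointHeat η (z, t) * fundSol (t, z) p = -η (p.2, p.1) := by
  rw [← integral_heatEvol_adjointHeat hη hc p.2 p.1, ← integral_indicator measurableSet_Ioi,
    ← integral_add_left_eq_self _ p.1]
  congr 1
  ext r
  by_cases hr : r ∈ Ioi (0 : ℝ)
  · rw [indicator_of_mem hr, ← integral_heatK_mul_eq _ _ hr]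
    congr 1
    ext z
    rw [fundSol_of_lt (by simpa using hr), mul_comm, heatK_comm]
    simp
  · rw [indicator_of_notMem hr]
    have : ∀ z, fundSol (p.1 + r, z) p = 0 := fun z => fundSol_of_le (by simpa using hr)
    simp [this]

/-- The potential of a source `h σ`, paired with `(∂ₜ + Δ) η`, gives `-∫ η h dσ`: exchange the
order of integration. The source may be singular, so that initial data (`σ` carried by the slice
`s = 0`) and both reaction terms are covered. -/
theorem integral_adjointHeat_potential (hη : ContDiff ℝ ∞ η) (hc : HasCompactSupport η)
    {σ : Measure (ℝ × (ℝ × ℝ))} [SFinite σ] {h : ℝ × (ℝ × ℝ) → ℝ} (hm : Measurable h) {R C : ℝ}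
    (hR : ∀ z t, R ≤ t → (z, t) ∉ tsupport η)
    (hC : ∀ z t, t < R → ∫⁻ p, ‖fundSol (t, z) p * h p‖ₑ ∂σ ≤ ENNReal.ofReal C) :
    Integrable (fun q : ℝ × (ℝ × ℝ) => adjointHeat η (q.2, q.1) * ∫ p, fundSol q p * h p ∂σ) ∧
    ∫ q : ℝ × (ℝ × ℝ), adjointHeat η (q.2, q.1) * ∫ p, fundSol q p * h p ∂σ =
      -∫ p, η (p.2, p.1) * h p ∂σ := by
  have hac : Continuous fun q : ℝ × (ℝ × ℝ) => adjointHeat η (q.2, q.1) :=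
    (continuous_adjointHeat hη).comp continuous_swap
  have hai : Integrable fun q : ℝ × (ℝ × ℝ) => adjointHeat η (q.2, q.1) := by
    refine hac.integrable_of_hasCompactSupport ?_
    refine HasCompactSupport.intro (hc.image continuous_swap) fun q hq => ?_
    exact adjointHeat_eq_zero fun h' => hq ⟨_, h', rfl⟩
  have hFm : Measurable fun x : (ℝ × (ℝ × ℝ)) × (ℝ × (ℝ × ℝ)) =>
      adjointHeat η (x.1.2, x.1.1) * (fundSol x.1 x.2 * h x.2) :=
    (hac.measurable.comp measurable_fst).mul
      (measurable_fundSol.mul (hm.comp measurable_snd))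
  have hF : Integrable (fun x : (ℝ × (ℝ × ℝ)) × (ℝ × (ℝ × ℝ)) =>
      adjointHeat η (x.1.2, x.1.1) * (fundSol x.1 x.2 * h x.2)) (volume.prod σ) := by
    refine ⟨hFm.aestronglyMeasurable, ?_⟩
    rw [hasFiniteIntegral_iff_enorm, lintegral_prod _ hFm.enorm.aemeasurable]
    calc _ ≤ ∫⁻ q : ℝ × (ℝ × ℝ), ‖adjointHeat η (q.2, q.1)‖ₑ * ENNReal.ofReal C := by
          refine lintegral_mono fun q => ?_
          simp only [enorm_mul (adjointHeat η _)]
          rcases lt_or_ge q.1 R with hq | hq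
          · have hm' : Measurable fun p => ‖fundSol q p * h p‖ₑ :=
              ((measurable_fundSol.comp measurable_prodMk_left).mul hm).enorm
            rw [lintegral_const_mul _ hm']
            exact mul_le_mul_right (hC q.2 q.1 hq) _
          · simp [adjointHeat_eq_zero (hR q.2 q.1 hq)]
      _ = (∫⁻ q : ℝ × (ℝ × ℝ), ‖adjointHeat η (q.2, q.1)‖ₑ) * ENNReal.ofReal C :=
          lintegral_mul_const _ hac.measurable.enorm
      _ < ⊤ := ENNReal.mul_lt_top hai.2 ENNReal.ofReal_lt_top
  refine ⟨?_, ?_⟩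
  · have := hF.integral_prod_left
    simp only [integral_const_mul] at this
    exact this
  · have hswap := integral_integral_swap (f := fun q p =>
      adjointHeat η (q.2, q.1) * (fundSol q p * h p)) hF
    simp only [integral_const_mul] at hswap
    rw [hswap, ← integral_neg]
    refine integral_congr_ae ?_
    filter_upwards [hF.prod_left_ae] with p hp
    have e1 : ∫ q : ℝ × (ℝ × ℝ), adjointHeat η (q.2, q.1) * (fundSol q p * h p) =
        ∫ t, ∫ z, adjointHeat η (z, t) * (fundSol (t, z) p * h p) :=
      integral_prod _ hp
    rw [e1]
    simp_rw [← mul_assoc, integral_mul_const]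
    rw [integral_adjointHeat_fundSol hη hc p]
    ring

/-- The mass of the initial data seen by the fundamental solution. -/
theorem lintegral_fundSol_initial_le (φ : (ℝ × ℝ) →ᵇ ℝ) (z : ℝ × ℝ) (t : ℝ) :
    ∫⁻ p, ‖fundSol (t, z) p * φ p.2‖ₑ ∂((Measure.dirac (0 : ℝ)).prod volume) ≤
      ENNReal.ofReal ‖φ‖ := by
  have hm : Measurable fun p : ℝ × (ℝ × ℝ) => ‖fundSol (t, z) p * φ p.2‖ₑ :=
    ((measurable_fundSol.comp measurable_prodMk_left).mul
      (φ.continuous.measurable.comp measurable_snd)).enorm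
  rw [lintegral_prod _ hm.aemeasurable, lintegral_dirac' _ hm.lintegral_prod_right']
  rcases le_or_gt t 0 with ht | ht
  · have : ∀ w, fundSol (t, z) (0, w) = 0 := fun w => fundSol_of_le ht
    simp [this]
  · have e : ∀ w, ‖fundSol (t, z) (0, w) * φ w‖ₑ ≤ ENNReal.ofReal (heatK z w t) *
        ENNReal.ofReal ‖φ‖ := fun w => by
      rw [fundSol_of_lt (by exact ht), ← ENNReal.ofReal_mul (by
        simpa using heatK_nonneg z w ht.le), ← ofReal_norm, norm_mul,
        Real.norm_of_nonneg (by simpa using heatK_nonneg z w ht.le)]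
      simp only [sub_zero]
      exact ENNReal.ofReal_le_ofReal
        (mul_le_mul_of_nonneg_left (φ.norm_coe_le_norm w) (heatK_nonneg z w ht.le))
    refine (lintegral_mono e).trans_eq ?_
    rw [lintegral_mul_const _ (by fun_prop), lintegral_heatK z ht, one_mul]

theorem integral_fundSol_initial (φ : (ℝ × ℝ) →ᵇ ℝ) (z : ℝ × ℝ) {t : ℝ} (ht : 0 < t) :
    ∫ p, fundSol (t, z) p * φ p.2 ∂((Measure.dirac (0 : ℝ)).prod volume) = heatEvol φ z t := by
  have hm : Measurable fun p : ℝ × (ℝ × ℝ) => fundSol (t, z) p * φ p.2 :=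
    (measurable_fundSol.comp measurable_prodMk_left).mul
      (φ.continuous.measurable.comp measurable_snd)
  rw [← integral_heatK_mul_eq _ z ht, Measure.dirac_prod,
    integral_map measurable_prodMk_left.aemeasurable hm.aestronglyMeasurable]
  congr 1
  ext w
  rw [fundSol_of_lt (by exact ht), sub_zero]

variable {ν : Measure (ℝ × ℝ)} {A : ℝ}

/-- The source `k`, switched off outside the time interval `(0, τ)`. -/
noncomputable def cutSource (τ : ℝ) (k : ℝ × ℝ → ℝ → ℝ) (p : ℝ × (ℝ × ℝ)) : ℝ :=
  (Ioo 0 τ ×ˢ univ).indicator (fun p : ℝ × (ℝ × ℝ) => k p.2 p.1) p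

theorem cutSource_of_mem {τ : ℝ} (k : ℝ × ℝ → ℝ → ℝ) {p : ℝ × (ℝ × ℝ)} (hp : p.1 ∈ Ioo 0 τ) :
    cutSource τ k p = k p.2 p.1 :=
  indicator_of_mem (s := Ioo 0 τ ×ˢ univ) ⟨hp, mem_univ _⟩ _

theorem cutSource_of_notMem {τ : ℝ} (k : ℝ × ℝ → ℝ → ℝ) {p : ℝ × (ℝ × ℝ)}
    (hp : p.1 ∉ Ioo 0 τ) : cutSource τ k p = 0 :=
  indicator_of_notMem (s := Ioo 0 τ ×ˢ univ) (fun h => hp h.1) _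

theorem abs_cutSource_le {τ B : ℝ} {k : ℝ × ℝ → ℝ → ℝ} (hB : 0 ≤ B)
    (hk : ∀ z, ∀ t ∈ Ioo 0 τ, |k z t| ≤ B) (p : ℝ × (ℝ × ℝ)) : |cutSource τ k p| ≤ B := by
  by_cases hp : p.1 ∈ Ioo 0 τ
  · rw [cutSource_of_mem k hp]; exact hk _ _ hp
  · rw [cutSource_of_notMem k hp, abs_zero]; exact hB

theorem measurable_cutSource {τ : ℝ} {k : ℝ × ℝ → ℝ → ℝ}
    (hk : ContinuousOn (fun p : (ℝ × ℝ) × ℝ => k p.1 p.2) (univ ×ˢ Ioo 0 τ)) :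
    Measurable (cutSource τ k) := by
  classical
  have h1 : ContinuousOn (fun p : ℝ × (ℝ × ℝ) => k p.2 p.1) (Ioo 0 τ ×ˢ univ) :=
    hk.comp continuous_swap.continuousOn fun p hp => ⟨mem_univ _, hp.1⟩
  have h2 := h1.measurable_piecewise (continuousOn_const (c := (0 : ℝ)))
    (measurableSet_Ioo.prod MeasurableSet.univ)
  have e : cutSource τ k = (Ioo 0 τ ×ˢ univ).piecewise (fun p : ℝ × (ℝ × ℝ) => k p.2 p.1)
      fun _ => 0 := (piecewise_eq_indicator ..).symm
  rwa [e]

theorem fundSol_mul_cutSource {τ t : ℝ} (ht : t < τ) (k : ℝ × ℝ → ℝ → ℝ) (z : ℝ × ℝ)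
    (p : ℝ × (ℝ × ℝ)) : fundSol (t, z) p * cutSource τ k p =
      (Ioo 0 t ×ˢ univ).indicator
        (fun p : ℝ × (ℝ × ℝ) => heatK z p.2 (t - p.1) * k p.2 p.1) p := by
  by_cases hp : p.1 ∈ Ioo 0 t
  · rw [indicator_of_mem (show p ∈ Ioo 0 t ×ˢ univ from ⟨hp, mem_univ _⟩),
      fundSol_of_lt hp.2, cutSource_of_mem k ⟨hp.1, hp.2.trans ht⟩]
  · rw [indicator_of_notMem (fun h => hp h.1)]
    rcases le_or_gt t p.1 with h | h
    · rw [fundSol_of_le h, zero_mul]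
    · rw [cutSource_of_notMem k fun h' => hp ⟨h'.1, h⟩, mul_zero]

theorem integral_fundSol_cutSource [SFinite ν] {τ t : ℝ} (ht : t < τ) (k : ℝ × ℝ → ℝ → ℝ)
    (z : ℝ × ℝ) :
    ∫ p, fundSol (t, z) p * cutSource τ k p ∂(volume.prod ν) =
      ∫ p, heatK z p.2 (t - p.1) * k p.2 p.1 ∂(spaceTime ν t) := by
  simp_rw [fundSol_mul_cutSource ht]
  rw [integral_indicator (measurableSet_Ioo.prod MeasurableSet.univ), ← spaceTime_eq_restrict]

theorem lintegral_fundSol_cutSource_le [SFinite ν] (hν : HasHeatBound ν A) {τ B : ℝ}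
    {k : ℝ × ℝ → ℝ → ℝ} (hB : 0 ≤ B) (hk : ∀ z, ∀ t ∈ Ioo 0 τ, |k z t| ≤ B) (z : ℝ × ℝ)
    (t : ℝ) (ht : t < τ) :
    ∫⁻ p, ‖fundSol (t, z) p * cutSource τ k p‖ₑ ∂(volume.prod ν) ≤
      ENNReal.ofReal (B * (A * laplaceWeight 1 * Real.exp τ)) := by
  simp_rw [fundSol_mul_cutSource ht, enorm_indicator_eq_indicator_enorm]
  rw [lintegral_indicator (measurableSet_Ioo.prod MeasurableSet.univ), ← spaceTime_eq_restrict]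
  calc _ ≤ ∫⁻ p, ENNReal.ofReal B *
        ENNReal.ofReal (heatK z p.2 (t - p.1) * Real.exp (1 * p.1)) ∂(spaceTime ν t) := by
        refine lintegral_mono_ae ?_
        filter_upwards [ae_spaceTime t] with p hp
        rw [← ENNReal.ofReal_mul hB, ← ofReal_norm]
        refine ENNReal.ofReal_le_ofReal (norm_heatK_mul_le z (fun w s hs => ?_) hp)
        refine (hk w s ⟨hs.1, hs.2.trans ht⟩).trans (le_mul_of_one_le_right hB ?_)
        exact Real.one_le_exp (by linarith [hs.1])
    _ = ENNReal.ofReal B *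
        ∫⁻ p, ENNReal.ofReal (heatK z p.2 (t - p.1) * Real.exp (1 * p.1)) ∂(spaceTime ν t) := by
        rw [lintegral_const_mul _ (by fun_prop)]
    _ ≤ ENNReal.ofReal B * ENNReal.ofReal (A * laplaceWeight 1 * Real.exp (1 * t)) :=
        mul_le_mul_right (lintegral_spaceTime_exp_le hν z t one_pos) _
    _ ≤ _ := by
        rw [← ENNReal.ofReal_mul hB]
        refine ENNReal.ofReal_le_ofReal (mul_le_mul_of_nonneg_left ?_ hB)
        refine mul_le_mul_of_nonneg_left (Real.exp_le_exp.2 (by linarith)) ?_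
        exact mul_nonneg hν.1 (laplaceWeight_nonneg one_pos)

end Duality

theorem exists_time_bound {T : EReal} (hT : 0 < T) {K : Set ℝ} (hK : IsCompact K)
    (hKT : K ⊆ timeInterval T) : ∃ τ ∈ timeInterval T, K ⊆ Ioo 0 τ := by
  rcases K.eq_empty_or_nonempty with rfl | hne
  · obtain ⟨q, hq1, hq2⟩ := EReal.lt_iff_exists_real_btwn.1 hT
    exact ⟨q, ⟨EReal.coe_lt_coe_iff.1 hq1, hq2⟩, empty_subset _⟩
  · obtain ⟨m, hm, hmax⟩ := hK.exists_isGreatest hne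
    obtain ⟨τ, hτ, hlt⟩ := exists_gt_mem_timeInterval (hKT hm)
    exact ⟨τ, hτ, fun t ht => ⟨(hKT ht).1, (hmax ht).trans_lt hlt⟩⟩

/-- Bounded mild solutions are weak solutions. On the support of the test function the solution
is the sum of three potentials, to which `integral_adjointHeat_potential` applies. -/
theorem isWeakSolution_of_mild {f g : ℝ → ℝ} (hf : Continuous f) (hg : Continuous g)
    {μ : Measure ℝ} [IsLocallyFiniteMeasure μ] {A : ℝ} (hμ : HasHeatBound (μ.prod volume) A)
    {φ : (ℝ × ℝ) →ᵇ ℝ} {T : EReal} {u : ℝ × ℝ → ℝ → ℝ}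
    (hu : IsBoundedMildSolution f g μ φ T u) : IsWeakSolution f g μ (timeInterval T) u := by
  refine ⟨hu.1.continuousOn, fun η hη hc hs => ?_⟩
  obtain ⟨τ, hτ, hKτ⟩ := exists_time_bound hu.1.pos (hc.image continuous_snd)
    (fun t ht => by obtain ⟨p, hp, rfl⟩ := ht; exact (hs hp).2)
  have hsub : Ioo 0 τ ⊆ timeInterval T := fun t ht => mem_timeInterval_of_le hτ ht.1 ht.2.le
  have hout : ∀ z t, t ∉ Ioo 0 τ → (z, t) ∉ tsupport η := fun z t ht h => ht (hKτ ⟨_, h, rfl⟩)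
  obtain ⟨M, hM⟩ := hu.2 τ hτ
  have hM0 : 0 ≤ M := (abs_nonneg _).trans (hM 0 τ ⟨hτ.1, le_rfl⟩)
  have huc : ContinuousOn (fun p : (ℝ × ℝ) × ℝ => u p.1 p.2) (univ ×ˢ Ioo 0 τ) :=
    hu.1.continuousOn.mono (prod_mono_right hsub)
  have hbd : ∀ k : ℝ → ℝ, Continuous k → ∃ B, 0 ≤ B ∧ ∀ z, ∀ t ∈ Ioo 0 τ, |k (u z t)| ≤ B := by
    intro k hk
    obtain ⟨B, hB⟩ := (isCompact_Icc (a := -M) (b := M)).exists_bound_of_continuousOn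
      hk.continuousOn
    exact ⟨B, (norm_nonneg _).trans (hB 0 ⟨by linarith, hM0⟩), fun z t ht =>
      hB _ (abs_le.1 (hM z t ⟨ht.1, ht.2.le⟩))⟩
  obtain ⟨Bf, hBf0, hBf⟩ := hbd f hf
  obtain ⟨Bg, hBg0, hBg⟩ := hbd g hg
  have mU := measurable_cutSource huc
  have mF := measurable_cutSource (k := fun z t => f (u z t)) (hf.comp_continuousOn huc)
  have mG := measurable_cutSource (k := fun z t => g (u z t)) (hg.comp_continuousOn huc)
  set U := cutSource τ u with hU
  set F := cutSource τ (fun z t => f (u z t)) with hF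
  set G := cutSource τ (fun z t => g (u z t)) with hG
  have hpair : ∀ {ρ : Measure (ℝ × (ℝ × ℝ))} [IsFiniteMeasureOnCompacts ρ]
      {V : ℝ × (ℝ × ℝ) → ℝ} {B : ℝ} {k : (ℝ × ℝ) × ℝ → ℝ}, Measurable V → (∀ p, |V p| ≤ B) →
      Continuous k → (∀ p, p ∉ tsupport η → k p = 0) →
      Integrable (fun q : ℝ × (ℝ × ℝ) => V q * k (q.2, q.1)) ρ := by
    intro ρ _ V B k hV hB hk hk0
    refine Integrable.bdd_mul ((hk.comp continuous_swap).integrable_of_hasCompactSupport ?_)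
      hV.aestronglyMeasurable (ae_of_all _ hB)
    exact HasCompactSupport.intro (hc.image continuous_swap) fun q hq =>
      hk0 _ fun h => hq ⟨_, h, rfl⟩
  have bU := abs_cutSource_le (τ := τ) hM0 fun z t ht => hM z t ⟨ht.1, ht.2.le⟩
  have bF := abs_cutSource_le hBf0 hBf
  have bG := abs_cutSource_le hBg0 hBg
  have hR : ∀ z t, τ ≤ t → (z, t) ∉ tsupport η := fun z t ht => hout z t fun h =>
    absurd h.2 (not_lt.2 ht)
  obtain ⟨i0, p0⟩ := integral_adjointHeat_potential hη hc
    (σ := (Measure.dirac (0 : ℝ)).prod volume) (h := fun p => φ p.2)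
    (φ.continuous.measurable.comp measurable_snd) hR
    (fun z t _ => lintegral_fundSol_initial_le φ z t)
  obtain ⟨i1, p1⟩ := integral_adjointHeat_potential hη hc (σ := volume.prod (μ.prod volume)) mF hR
    (lintegral_fundSol_cutSource_le hμ hBf0 hBf)
  obtain ⟨i2, p2⟩ := integral_adjointHeat_potential hη hc
    (σ := volume.prod (volume : Measure (ℝ × ℝ))) mG hR
    (lintegral_fundSol_cutSource_le hasHeatBound_volume hBg0 hBg)
  have hinit : ∫ p : ℝ × (ℝ × ℝ), η (p.2, p.1) * φ p.2
      ∂((Measure.dirac (0 : ℝ)).prod volume) = 0 := by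
    have hcont : Continuous fun p : ℝ × (ℝ × ℝ) => η (p.2, p.1) * φ p.2 :=
      (hη.continuous.comp continuous_swap).mul (φ.continuous.comp continuous_snd)
    rw [Measure.dirac_prod, integral_map measurable_prodMk_left.aemeasurable
      hcont.aestronglyMeasurable]
    have : ∀ w, η (w, 0) = 0 := fun w =>
      image_eq_zero_of_notMem_tsupport (hout w 0 fun h => lt_irrefl _ h.1)
    simp [this]
  -- the Duhamel formula: `u` is the sum of the potentials of its initial data and its two sources
  have hrep : ∀ q : ℝ × (ℝ × ℝ), U q * adjointHeat η (q.2, q.1) =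
      adjointHeat η (q.2, q.1) *
        (∫ p, fundSol q p * φ p.2 ∂((Measure.dirac (0 : ℝ)).prod volume)) +
      (adjointHeat η (q.2, q.1) * (∫ p, fundSol q p * F p ∂(volume.prod (μ.prod volume))) +
        adjointHeat η (q.2, q.1) * (∫ p, fundSol q p * G p ∂(volume.prod volume))) := by
    rintro ⟨t, z⟩
    by_cases ht : t ∈ Ioo 0 τ
    · have e := hu.1.eq_heatEvol_add z (hsub ht)
      rw [hU, cutSource_of_mem (p := (t, z)) u ht]
      simp only
      rw [e, integral_fundSol_initial φ z ht.1, hF, hG, integral_fundSol_cutSource ht.2,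
        integral_fundSol_cutSource ht.2]
      ring
    · simp [adjointHeat_eq_zero (hout z t ht)]
  have hmain : ∫ q : ℝ × (ℝ × ℝ), U q * adjointHeat η (q.2, q.1) =
      -(∫ p, η (p.2, p.1) * F p ∂(volume.prod (μ.prod volume))) +
        -∫ p : ℝ × (ℝ × ℝ), η (p.2, p.1) * G p := by
    simp_rw [hrep]
    rw [integral_add_add i0 i1 i2, p0, p1, p2, hinit, neg_zero, zero_add]
    rfl
  -- all integrands vanish outside `(0, τ)`, so the iterated integrals over `(0, T)` are integrals
  -- of the cut-off functions over space-time
  have toU : ∀ {k : (ℝ × ℝ) × ℝ → ℝ}, (∀ p, p ∉ tsupport η → k p = 0) → ∀ z t,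
      u z t * k (z, t) = U (t, z) * k (z, t) := by
    intro k hk z t
    by_cases ht : t ∈ Ioo 0 τ
    · rw [hU, cutSource_of_mem (p := (t, z)) u ht]
    · rw [hk _ (hout z t ht), mul_zero, mul_zero]
  have hη0 : ∀ p, p ∉ tsupport η → η p = 0 := fun p hp => image_eq_zero_of_notMem_tsupport hp
  have hset : ∀ {ν : Measure (ℝ × ℝ)} {k : ℝ × ℝ → ℝ → ℝ}, (∀ z t, t ∉ Ioo 0 τ → k z t = 0) →
      ∫ t in timeInterval T, ∫ z, k z t ∂ν = ∫ t, ∫ z, k z t ∂ν := fun {ν k} hk =>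
    setIntegral_eq_integral_of_forall_compl_eq_zero fun t ht => by
      simp [fun z => hk z t fun h => ht (hsub h)]
  have dT := fun p (hp : p ∉ tsupport η) => partialD_eq_zero (η := η) (0, 1) hp
  have dX := fun p (hp : p ∉ tsupport η) =>
    partialD_partialD_eq_zero (η := η) ((1, 0), 0) ((1, 0), 0) hp
  have dY := fun p (hp : p ∉ tsupport η) =>
    partialD_partialD_eq_zero (η := η) ((0, 1), 0) ((0, 1), 0) hp
  have hD := fun v => contDiff_partialD hη v
  have jT := hpair (ρ := volume) mU bU (hD _).continuous dT
  have jX := hpair (ρ := volume) mU bU (contDiff_partialD (hD _) _).continuous dX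
  have jY := hpair (ρ := volume) mU bU (contDiff_partialD (hD _) _).continuous dY
  have jG := hpair (ρ := volume) mG bG hη.continuous hη0
  have jF := hpair (ρ := volume.prod (μ.prod volume)) mF bF hη.continuous hη0
  have L1 : ∫ t in timeInterval T, ∫ z : ℝ × ℝ, u z t * deriv (fun s => η (z, s)) t =
      ∫ q : ℝ × (ℝ × ℝ), U q * partialD (0, 1) η (q.2, q.1) := by
    simp_rw [fun z t => (hasDerivAt_time hη z t).deriv, toU dT]
    rw [hset fun z t ht => by rw [dT _ (hout z t ht), mul_zero]]
    exact (integral_prod _ jT).symm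
  have L2 : ∫ t in timeInterval T, ∫ z : ℝ × ℝ,
        (u z t * iteratedDeriv 2 (fun x => η ((x, z.2), t)) z.1
          + u z t * iteratedDeriv 2 (fun y => η ((z.1, y), t)) z.2
          + g (u z t) * η (z, t)) =
      ∫ q : ℝ × (ℝ × ℝ), (U q * partialD ((1, 0), 0) (partialD ((1, 0), 0) η) (q.2, q.1) +
        (U q * partialD ((0, 1), 0) (partialD ((0, 1), 0) η) (q.2, q.1) +
        G q * η (q.2, q.1))) := by
    have toG : ∀ z t, g (u z t) * η (z, t) = G (t, z) * η (z, t) := by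
      intro z t
      by_cases ht : t ∈ Ioo 0 τ
      · rw [hG, cutSource_of_mem (p := (t, z)) _ ht]
      · rw [hη0 _ (hout z t ht), mul_zero, mul_zero]
    simp_rw [fun z t => iteratedDeriv_two_x hη z t, fun z t => iteratedDeriv_two_y hη z t,
      toU dX, toU dY, toG, add_assoc]
    rw [hset fun z t ht => by
      rw [dX _ (hout z t ht), dY _ (hout z t ht), hη0 _ (hout z t ht)]; simp]
    exact (integral_prod _ (jX.add (jY.add jG))).symm
  have L3 : ∫ t in timeInterval T, ∫ z : ℝ × ℝ, f (u z t) * η (z, t) ∂(μ.prod volume) =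
      ∫ q, F q * η (q.2, q.1) ∂(volume.prod (μ.prod volume)) := by
    have toF : ∀ z t, f (u z t) * η (z, t) = F (t, z) * η (z, t) := by
      intro z t
      by_cases ht : t ∈ Ioo 0 τ
      · rw [hF, cutSource_of_mem (p := (t, z)) _ ht]
      · rw [hη0 _ (hout z t ht), mul_zero, mul_zero]
    simp_rw [toF]
    rw [hset fun z t ht => by rw [hη0 _ (hout z t ht), mul_zero]]
    exact (integral_prod _ jF).symm
  rw [L1, L2, L3, integral_add_add jX jY jG]
  have hsplit : ∫ q : ℝ × (ℝ × ℝ), U q * adjointHeat η (q.2, q.1) =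
      (∫ q : ℝ × (ℝ × ℝ), U q * partialD (0, 1) η (q.2, q.1)) +
      ((∫ q : ℝ × (ℝ × ℝ), U q * partialD ((1, 0), 0) (partialD ((1, 0), 0) η) (q.2, q.1)) +
        ∫ q : ℝ × (ℝ × ℝ), U q * partialD ((0, 1), 0) (partialD ((0, 1), 0) η) (q.2, q.1)) := by
    rw [← integral_add_add jT jX jY]
    simp_rw [adjointHeat, mul_add]
  simp_rw [mul_comm (η _)] at hmain
  linarith

/-! ### Local existence, uniqueness and continuous dependence -/

section

variable {f g : ℝ → ℝ} {μ : Measure ℝ} [SFinite μ] {A : ℝ}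

theorem IsBoundedMildSolution.to_trunc {φ : ℝ × ℝ → ℝ} {T : EReal} {u : ℝ × ℝ → ℝ → ℝ}
    (hu : IsBoundedMildSolution f g μ φ T u) {τ M : ℝ} (hτ : τ ∈ timeInterval T)
    (hM : ∀ z, ∀ t ∈ Ioc 0 τ, |u z t| ≤ M) :
    IsBoundedMildSolution (trunc f M) (trunc g M) μ φ τ u :=
  hu.congr (EReal.coe_pos.2 hτ.1) hτ.2.le
    (fun z t ht => (trunc_eq f (hM z t (Ioo_subset_Ioc_self (mem_timeInterval_coe.1 ht)))).symm)
    (fun z t ht => (trunc_eq g (hM z t (Ioo_subset_Ioc_self (mem_timeInterval_coe.1 ht)))).symm)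

theorem IsBoundedMildSolution.of_trunc {φ : ℝ × ℝ → ℝ} {T : EReal} {u : ℝ × ℝ → ℝ → ℝ} {τ M : ℝ}
    (hu : IsBoundedMildSolution (trunc f M) (trunc g M) μ φ T u) (hτ0 : 0 < τ) (hτT : τ ≤ T)
    (hM : ∀ z, ∀ t ∈ Ioo 0 τ, |u z t| ≤ M) : IsBoundedMildSolution f g μ φ τ u :=
  hu.congr (EReal.coe_pos.2 hτ0) hτT
    (fun z t ht => trunc_eq f (hM z t (mem_timeInterval_coe.1 ht)))
    (fun z t ht => trunc_eq g (hM z t (mem_timeInterval_coe.1 ht)))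

theorem IsBoundedMildSolution.restrict {φ : ℝ × ℝ → ℝ} {S T : EReal} {u : ℝ × ℝ → ℝ → ℝ}
    (hu : IsBoundedMildSolution f g μ φ T u) (hS : 0 < S) (hST : S ≤ T) :
    IsBoundedMildSolution f g μ φ S u :=
  hu.congr hS hST (fun _ _ _ => rfl) fun _ _ _ => rfl

/-- Local existence: the global solution of the truncated problem stays below the truncation
level for a short time. The smallness of the Duhamel integral comes from the factor `c(λ)` in
the weighted estimate, on the time scale `1 / λ`. -/
theorem exists_local_mild (hμ : HasHeatBound (μ.prod volume) A) (hf : LocallyLipschitz f)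
    (hg : LocallyLipschitz g) (φ : (ℝ × ℝ) →ᵇ ℝ) :
    ∃ T : EReal, 0 < T ∧ ∃ u, IsBoundedMildSolution f g μ φ T u := by
  have hM : 0 ≤ ‖φ‖ + 1 := by positivity
  obtain ⟨K, B, hB0, ⟨hfK, hgK⟩, hfB, hgB⟩ := exists_common_lipschitz_trunc hf hg hM
  obtain ⟨u, hu⟩ := exists_global_mild hμ hfK hgK hB0 hfB hgB φ
  obtain ⟨l, hl, hsmall⟩ := exists_laplaceWeight_le (B * (A + 1)) (ε := (Real.exp 1)⁻¹)
    (by positivity)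
  refine ⟨((1 / l : ℝ) : EReal), EReal.coe_pos.2 (by positivity), u,
    hu.of_trunc (by positivity) le_top fun z t ht => ?_⟩
  have htT : t ∈ timeInterval ⊤ := ⟨ht.1, EReal.coe_lt_top t⟩
  have hexp : ∀ s ∈ Ioo 0 t, B ≤ B * Real.exp (l * s) := fun s hs =>
    le_mul_of_one_le_right hB0 (Real.one_le_exp (mul_nonneg hl.le hs.1.le))
  have e1 := abs_heatEvol_le (φ := φ) φ.norm_coe_le_norm z t
  have e2 := abs_integral_spaceTime_le hμ (h := fun w s => trunc f (‖φ‖ + 1) (u w s)) hB0 hl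
    (fun w s hs => (hfB _).trans (hexp s hs)) z
  have e3 := abs_integral_spaceTime_le hasHeatBound_volume
    (h := fun w s => trunc g (‖φ‖ + 1) (u w s)) hB0 hl
    (fun w s hs => (hgB _).trans (hexp s hs)) z
  have h1 : l * t ≤ 1 := by
    have := mul_le_mul_of_nonneg_left ht.2.le hl.le
    rwa [mul_one_div_cancel hl.ne'] at this
  have h2 : B * (A + 1) * laplaceWeight l * Real.exp (l * t) ≤ 1 := by
    calc _ ≤ (Real.exp 1)⁻¹ * Real.exp 1 :=
          mul_le_mul hsmall (Real.exp_le_exp.2 h1) (Real.exp_pos _).le (by positivity)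
      _ = 1 := inv_mul_cancel₀ (Real.exp_pos _).ne'
  rw [hu.1.eq_heatEvol_add z htT]
  refine (abs_add_le _ _).trans ((add_le_add e1 ((abs_add_le _ _).trans
    (add_le_add e2 e3))).trans ?_)
  linarith

/-- Uniqueness: up to any `τ < T` both solutions solve the same truncated problem. -/
theorem eq_of_mild (hμ : HasHeatBound (μ.prod volume) A) (hf : LocallyLipschitz f)
    (hg : LocallyLipschitz g) {φ : (ℝ × ℝ) →ᵇ ℝ} {T : EReal} {u v : ℝ × ℝ → ℝ → ℝ}
    (hu : IsBoundedMildSolution f g μ φ T u) (hv : IsBoundedMildSolution f g μ φ T v)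
    (z : ℝ × ℝ) {t : ℝ} (ht : t ∈ timeInterval T) : u z t = v z t := by
  obtain ⟨τ, hτ, htτ⟩ := exists_gt_mem_timeInterval ht
  obtain ⟨M, hM⟩ := hu.2 τ hτ
  obtain ⟨M', hM'⟩ := hv.2 τ hτ
  have hM0 : 0 ≤ M := (abs_nonneg _).trans (hM 0 τ ⟨hτ.1, le_rfl⟩)
  obtain ⟨K, B, -, ⟨hfK, hgK⟩, -, -⟩ :=
    exists_common_lipschitz_trunc hf hg (hM0.trans (le_max_left M M'))
  obtain ⟨l, hl⟩ := exists_contractionExponent K A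
  have key := abs_sub_le_of_mild hμ hfK hgK hl
    (hu.to_trunc hτ fun z t ht => (hM z t ht).trans (le_max_left _ _))
    (hv.to_trunc hτ fun z t ht => (hM' z t ht).trans (le_max_right _ _)) z
    (mem_timeInterval_coe.2 ⟨ht.1, htτ⟩)
  rw [dist_self, mul_zero, zero_mul] at key
  exact sub_eq_zero.1 (abs_nonpos_iff.1 key)

/-- Near a bounded mild solution `u` on `(0, T)`, the problem is solvable up to any `τ < T` for all
initial data close to that of `u`, with Lipschitz dependence on the data: truncate the
nonlinearities one unit above the bound of `u`. -/
theorem exists_mild_near (hμ : HasHeatBound (μ.prod volume) A) (hf : LocallyLipschitz f)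
    (hg : LocallyLipschitz g) {φ : (ℝ × ℝ) →ᵇ ℝ} {T : EReal} {u : ℝ × ℝ → ℝ → ℝ}
    (hu : IsBoundedMildSolution f g μ φ T u) {τ : ℝ} (hτ : τ ∈ timeInterval T) :
    ∃ C δ : ℝ, 0 < δ ∧ ∀ ψ : (ℝ × ℝ) →ᵇ ℝ, dist φ ψ < δ →
      ∃ v, IsBoundedMildSolution f g μ ψ τ v ∧
        ∀ z, ∀ t ∈ Ioo 0 τ, |u z t - v z t| ≤ C * dist φ ψ := by
  obtain ⟨M, hM⟩ := hu.2 τ hτ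
  have hM0 : 0 ≤ M := (abs_nonneg _).trans (hM 0 τ ⟨hτ.1, le_rfl⟩)
  obtain ⟨K, B, hB0, ⟨hfK, hgK⟩, hfB, hgB⟩ :=
    exists_common_lipschitz_trunc hf hg (show 0 ≤ M + 1 by linarith)
  obtain ⟨l, hl⟩ := exists_contractionExponent K A
  have hut := hu.to_trunc hτ fun z t ht => (hM z t ht).trans (by linarith : M ≤ M + 1)
  set C := 2 * Real.exp (l * τ) with hC
  have hC0 : 0 < C := by positivity
  refine ⟨C, 1 / C, by positivity, fun ψ hψ => ?_⟩
  obtain ⟨v, hv⟩ := exists_global_mild hμ hfK hgK hB0 hfB hgB ψ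
  have hdist : ∀ z, ∀ t ∈ Ioo 0 τ, |u z t - v z t| ≤ C * dist φ ψ := fun z t ht => by
    refine (abs_sub_le_of_mild hμ hfK hgK hl hut
      (hv.restrict (EReal.coe_pos.2 hτ.1) le_top) z (mem_timeInterval_coe.2 ht)).trans ?_
    rw [hC, mul_right_comm]
    refine mul_le_mul_of_nonneg_right (mul_le_mul_of_nonneg_left (Real.exp_le_exp.2 ?_)
      zero_le_two) dist_nonneg
    exact mul_le_mul_of_nonneg_left ht.2.le hl.1.le
  refine ⟨v, hv.of_trunc hτ.1 le_top fun z t ht => ?_, hdist⟩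
  have h1 : C * dist φ ψ ≤ 1 := by
    have := (lt_div_iff₀ hC0).1 hψ
    linarith
  have h2 := abs_sub_abs_le_abs_sub (v z t) (u z t)
  rw [abs_sub_comm] at h2
  linarith [hdist z t ht, hM z t ⟨ht.1, ht.2.le⟩]

end

end StratifiedKPP

theorem theorem5p1 (L α : ℝ) (hL : 0 < L) (hα : 0 < α)
    (f g : ℝ → ℝ) (hf : LocallyLipschitz f) (hg : LocallyLipschitz g)
    (μ : Measure ℝ) (hμ : μ ∈ StratifiedKPP.LamBar L α)
    (u₀ : (ℝ × ℝ) →ᵇ ℝ) (hu₀ : ∀ z, 0 ≤ u₀ z) :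
    -- local existence
    (∃ T : EReal, 0 < T ∧ ∃ u : ℝ × ℝ → ℝ → ℝ,
      StratifiedKPP.IsBoundedMildSolution f g μ u₀ T u) ∧
    -- uniqueness, on every time interval
    (∀ (T : EReal) (u v : ℝ × ℝ → ℝ → ℝ),
      StratifiedKPP.IsBoundedMildSolution f g μ u₀ T u →
      StratifiedKPP.IsBoundedMildSolution f g μ u₀ T v →
      ∀ z, ∀ t ∈ StratifiedKPP.timeInterval T, u z t = v z t) ∧
    (∀ (T : EReal) (u : ℝ × ℝ → ℝ → ℝ),
      StratifiedKPP.IsBoundedMildSolution f g μ u₀ T u →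
      -- the mild solution is a weak solution
      StratifiedKPP.IsWeakSolution f g μ (StratifiedKPP.timeInterval T) u ∧
      -- continuous dependence on the initial data in the supremum norm
      ∀ v₀ : ℕ → (ℝ × ℝ) →ᵇ ℝ, (∀ n z, 0 ≤ v₀ n z) → Tendsto v₀ atTop (𝓝 u₀) →
        ∀ t ∈ StratifiedKPP.timeInterval T,
          (∀ᶠ n in atTop, ∃ (S : EReal) (v : ℝ × ℝ → ℝ → ℝ), (t : EReal) < S ∧
            StratifiedKPP.IsBoundedMildSolution f g μ (v₀ n) S v) ∧
          ∀ (S : ℕ → EReal) (v : ℕ → ℝ × ℝ → ℝ → ℝ),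
            (∀ᶠ n in atTop, (t : EReal) < S n ∧
              StratifiedKPP.IsBoundedMildSolution f g μ (v₀ n) (S n) (v n)) →
            TendstoUniformly (fun n z => v n z t) (fun z => u z t) atTop) := by
  open StratifiedKPP in
  have : IsLocallyFiniteMeasure μ := hμ.1
  have hA := hasHeatBound_prod hL (by positivity) (LamBar.measure_Icc_le hL hμ)
  refine ⟨exists_local_mild hA hf hg u₀, fun T u v hu hv z t ht => eq_of_mild hA hf hg hu hv z ht,
    fun T u hu => ⟨isWeakSolution_of_mild hf.continuous hg.continuous hA hu,
      fun v₀ _ hv₀ t ht => ?_⟩⟩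
  obtain ⟨τ, hτ, htτ⟩ := exists_gt_mem_timeInterval ht
  obtain ⟨C, δ, hδ, hnear⟩ := exists_mild_near hA hf hg hu hτ
  have hdist : Tendsto (fun n => dist u₀ (v₀ n)) atTop (𝓝 0) := by
    simpa only [dist_comm] using tendsto_iff_dist_tendsto_zero.1 hv₀
  have hclose := hdist.eventually (gt_mem_nhds hδ)
  refine ⟨?_, fun S v hv => ?_⟩
  · filter_upwards [hclose] with n hn
    obtain ⟨w, hw, -⟩ := hnear _ hn
    exact ⟨τ, w, EReal.coe_lt_coe_iff.2 htτ, hw⟩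
  · have hCd : Tendsto (fun n => C * dist u₀ (v₀ n)) atTop (𝓝 0) := by
      simpa using hdist.const_mul C
    rw [Metric.tendstoUniformly_iff]
    intro ε hε
    filter_upwards [hclose, hv, hCd.eventually (gt_mem_nhds hε)] with n hn hvn hεn z
    obtain ⟨w, hw, hwu⟩ := hnear _ hn
    -- on the common interval `v n` is the solution that is known to be close to `u`
    have hpos : 0 < min (S n) (τ : EReal) := lt_min hvn.2.1.pos hw.1.pos
    have hvw : v n z t = w z t := eq_of_mild hA hf hg (hvn.2.restrict hpos (min_le_left _ _))
      (hw.restrict hpos (min_le_right _ _)) z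
      ⟨ht.1, lt_min hvn.1 (EReal.coe_lt_coe_iff.2 htτ)⟩
    rw [Real.dist_eq, hvw]
    exact (hwu z t ⟨ht.1, htτ⟩).trans_lt hεn
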